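/- **Conventions.** A Frölicher space is a set with a set of curves $\mathbb{R}\to X$ and a set $\mathcal{C}^\infty(X)$ of functions $X\to\mathbb{R}$ that determine each other: a map is a function iff its composites with all curves are $\mathcal{C}^\infty$, and a map is a curve iff its composites with all functions are $\mathcal{C}^\infty$. Let $\mathbf{FS}$ be the cartesian closed category of Frölicher spaces and smooth maps; $X^Y=\mathcal{C}^\infty(Y,X)$ denotes the exponential. A Weil algebra $W$ is given in the form $\mathcal{C}^\infty(\mathbb{R}^k)/I$, a finite-dimensional local algebra whose ideal $I$ consists of functions vanishing at $0$; $\otimes_\infty$ is the coproduct of $\mathcal{C}^\infty$-rings. The Weil prolongation $X\otimes W$ is the set of classes of smooth $f:\mathbb{R}^k\to X$ under $$f\equiv g \iff f(0)=g(0)\ \text{ and }\ \chi\circ f-\chi\circ g\in I\ \text{ for all }\chi\in\mathcal{C}^\infty(X),$$ with the initial Frölicher structure for the maps $\chi\otimes W:X\otimes W\to\mathbb{R}\otimes W=W$, $[f]\mapsto[\chi\circ f]$, where $W$ is a finite-dimensional vector space. $X$ is Weil-exponentiable if, for every Frölicher space $Y$ and all Weil algebras $W_1,W_2$ (presented over $\mathbb{R}^k$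 and $\mathbb{R}^l$), there is an isomorphism of Frölicher spaces $$(X\otimes(W_1\otimes_\infty W_2))^Y\;\cong\;(X\otimes W_1)^Y\otimes W_2$$ which is the canonical one, i.e. is given at each point of $Y$ by sending the class of $F:\mathbb{R}^k\times\mathbb{R}^l\to X$ to the class of $z\mapsto[F(\cdot,z)]$. Let $\mathbf{FS}_{\mathbf{WE}}\subset\mathbf{FS}$ be the full subcategory of Weil-exponentiable spaces, and $\mathbf{D}$ the full subcategory of $\mathcal{C}^\infty$-rings of the form $C=\mathcal{C}^\infty(\mathbb{R}^n)\otimes_\infty W$. For such $C$ and $X\in\mathbf{FS}_{\mathbf{WE}}$ put $X\otimes C=\mathcal{C}^\infty(\mathbb{R}^n,X)\otimes W$, which is functorial in $X$. **Assumption (the standing conjecture).** $X\otimes C$ is functorial in $C$: for every morphism $\alpha:C\to C'$ of $\mathbf{D}$, substitution in representatives of the smooth maps $\mathbb{R}^{n'}\times\mathbb{R}^{k'}\to\mathbb{R}^{n}\times\mathbb{R}^{k}$ that induce $\alpha$ gives a well-defined smooth map $X\otimes\alpha:X\otimes C\to X\otimes C'$, and these maps are compatible with identities, with composition and with the functoriality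 in $X$, so that $\otimes$ is a bifunctor on $\mathbf{FS}_{\mathbf{WE}}\times\mathbf{D}$. Let $\mathbf{J}:\mathbf{FS}_{\mathbf{WE}}\to\mathbf{Sets}^{\mathbf{D}}$, $\mathbf{J}(X)(C)=X\otimes C$ (underlying set), be the exponential adjoint of this bifunctor followed by the underlying-set functor. **Proposition.** Under this assumption, for all Weil-exponentiable Frölicher spaces $X$ and $Y$, the product $X\times Y$ is Weil-exponentiable and the canonical natural transformation $$(\mathbf{J}(\pi_1),\mathbf{J}(\pi_2)):\ \mathbf{J}(X\times Y)\longrightarrow\mathbf{J}(X)\times\mathbf{J}(Y)$$ is an isomorphism in $\mathbf{Sets}^{\mathbf{D}}$. Consequently the functor $\mathbf{J}$ preserves binary products. -/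

import Mathlib

open CategoryTheory CategoryTheory.Limits
open scoped ContDiff

universe u v w

/-! ## Frölicher spaces -/

/-- A Frölicher structure on a set: curves and functions determine each other through the
condition that their composites are smooth maps from the real line to itself. -/
class FrolicherSpace (X : Type u) where
  curves : Set (ℝ → X)
  functions : Set (X → ℝ)
  mem_functions_iff : ∀ f : X → ℝ, f ∈ functions ↔ ∀ c ∈ curves, ContDiff ℝ ∞ (f ∘ c)
  mem_curves_iff : ∀ c : ℝ → X, c ∈ curves ↔ ∀ f ∈ functions, ContDiff ℝ ∞ (f ∘ c)

namespace FrolicherSpace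

/-- The Frölicher structure generated by a set of curves. -/
@[reducible] def ofCurves {X : Type u} (C : Set (ℝ → X)) : FrolicherSpace X where
  functions := {f | ∀ c ∈ C, ContDiff ℝ ∞ (f ∘ c)}
  curves := {c | ∀ f : X → ℝ, (∀ d ∈ C, ContDiff ℝ ∞ (f ∘ d)) → ContDiff ℝ ∞ (f ∘ c)}
  mem_functions_iff f := ⟨fun hf _ hc => hc f hf, fun hf c hc => hf c fun _ hg => hg c hc⟩
  mem_curves_iff _ := Iff.rfl

/-- The Frölicher structure generated by a set of functions. -/
@[reducible] def ofFunctions {X : Type u} (F : Set (X → ℝ)) : FrolicherSpace X where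
  curves := {c | ∀ f ∈ F, ContDiff ℝ ∞ (f ∘ c)}
  functions := {f | ∀ c : ℝ → X, (∀ g ∈ F, ContDiff ℝ ∞ (g ∘ c)) → ContDiff ℝ ∞ (f ∘ c)}
  mem_functions_iff _ := Iff.rfl
  mem_curves_iff c := ⟨fun hc _ hf => hf c hc, fun hc f hf => hc f fun _ hd => hd f hf⟩

/-- The real line: its curves and its functions are the smooth maps from `ℝ` to `ℝ`. -/
instance instReal : FrolicherSpace ℝ where
  curves := {c | ContDiff ℝ ∞ c}
  functions := {f | ContDiff ℝ ∞ f}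
  mem_functions_iff _ := ⟨fun hf _ hc => ContDiff.comp hf hc, fun hf => hf (fun t => t) (show ContDiff ℝ ∞ fun t : ℝ => t from contDiff_id)⟩
  mem_curves_iff _ := ⟨fun hc _ hf => ContDiff.comp hf hc, fun hc => hc (fun t => t) (show ContDiff ℝ ∞ fun t : ℝ => t from contDiff_id)⟩

/-- The space `ℝⁿ` with its smooth curves. By Boman's theorem its functions are exactly the
infinitely differentiable functions. -/
instance instPiReal (n : ℕ) : FrolicherSpace (Fin n → ℝ) :=
  ofCurves {c | ContDiff ℝ ∞ c}

/-- The product of two Frölicher spaces: the initial structure for the two projections. -/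
instance instProd (X : Type u) (Y : Type v) [FrolicherSpace X] [FrolicherSpace Y] :
    FrolicherSpace (X × Y) where
  curves := {c | Prod.fst ∘ c ∈ curves ∧ Prod.snd ∘ c ∈ curves}
  functions := {f | ∀ c : ℝ → X × Y, Prod.fst ∘ c ∈ curves ∧ Prod.snd ∘ c ∈ curves →
    ContDiff ℝ ∞ (f ∘ c)}
  mem_functions_iff _ := Iff.rfl
  mem_curves_iff c := by
    refine ⟨fun hc f hf => hf c hc, fun hc => ⟨?_, ?_⟩⟩
    · exact (mem_curves_iff _).2 fun f hf =>
        hc (f ∘ Prod.fst) fun d hd => (mem_curves_iff _).1 hd.1 f hf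
    · exact (mem_curves_iff _).2 fun f hf =>
        hc (f ∘ Prod.snd) fun d hd => (mem_curves_iff _).1 hd.2 f hf

theorem const_mem_curves {X : Type u} [FrolicherSpace X] (x : X) :
    (fun _ : ℝ => x) ∈ curves (X := X) :=
  (mem_curves_iff _).2 fun _ _ => contDiff_const

end FrolicherSpace

open FrolicherSpace

/-- Smooth maps between Frölicher spaces. -/
structure SmoothMap (X : Type u) (Y : Type v) [FrolicherSpace X] [FrolicherSpace Y] where
  toFun : X → Y
  smooth : ∀ c ∈ curves (X := X), toFun ∘ c ∈ curves (X := Y)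

namespace SmoothMap

variable {X : Type u} {Y : Type v} {Z : Type w}
  [FrolicherSpace X] [FrolicherSpace Y] [FrolicherSpace Z]

instance : FunLike (SmoothMap X Y) X Y where
  coe := toFun
  coe_injective f g h := by cases f; cases g; congr

@[ext] theorem ext {f g : SmoothMap X Y} (h : ∀ x, f x = g x) : f = g :=
  DFunLike.ext f g h

/-- The identity map. -/
def id (X : Type u) [FrolicherSpace X] : SmoothMap X X := ⟨fun x => x, fun _ hc => hc⟩

/-- Composition of smooth maps. -/
def comp (g : SmoothMap Y Z) (f : SmoothMap X Y) : SmoothMap X Z :=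
  ⟨fun x => g (f x), fun c hc => g.smooth _ (f.smooth c hc)⟩

/-- The first projection of a product. -/
def fst : SmoothMap (X × Y) X := ⟨Prod.fst, fun _ hc => hc.1⟩

/-- The second projection of a product. -/
def snd : SmoothMap (X × Y) Y := ⟨Prod.snd, fun _ hc => hc.2⟩

/-- The restriction of a smooth map on `X × Y` to the slice `X × {y}`. -/
def slice (f : SmoothMap (X × Y) Z) (y : Y) : SmoothMap X Z :=
  ⟨fun x => f (x, y), fun c hc => f.smooth (fun t => (c t, y)) ⟨hc, const_mem_curves y⟩⟩

/-- The exponential `Y ^ X` in the category of Frölicher spaces: the set of smooth maps from `X`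
to `Y`, with the structure generated by the curves `c` whose adjoint `ℝ × X → Y` is smooth. -/
instance instFrolicherSpace : FrolicherSpace (SmoothMap X Y) :=
  ofCurves {c | ∀ s : ℝ → ℝ, ContDiff ℝ ∞ s → ∀ d ∈ curves (X := X),
    (fun t => c (s t) (d t)) ∈ curves (X := Y)}

/-- A map is smooth once it pulls functions back to functions. -/
def ofFunctions (f : X → Y) (hf : ∀ χ ∈ functions (X := Y), χ ∘ f ∈ functions (X := X)) :
    SmoothMap X Y :=
  ⟨f, fun c hc => (mem_curves_iff _).2 fun χ hχ => (mem_functions_iff _).1 (hf χ hχ) c hc⟩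

/-- Evaluation at a point, as a smooth map from `Y ^ X` to `Y`. -/
def evalAt (x : X) : SmoothMap (SmoothMap X Y) Y :=
  ofFunctions (fun f => f x) fun χ hχ _ hc =>
    (mem_curves_iff _).1 (hc _root_.id contDiff_id _ (const_mem_curves x)) χ hχ

/-- Composition with a smooth map `Y → Z`, as a smooth map from `Y ^ X` to `Z ^ X`. -/
def postcomp (X : Type u) [FrolicherSpace X] (g : SmoothMap Y Z) :
    SmoothMap (SmoothMap X Y) (SmoothMap X Z) :=
  ofFunctions (fun f => g.comp f) fun _ hχ c hc =>
    hχ (fun t => g.comp (c t)) fun s hs d hd => g.smooth _ (hc s hs d hd)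

end SmoothMap

/-- An isomorphism of Frölicher spaces. -/
structure FrolicherIso (X : Type u) (Y : Type v) [FrolicherSpace X] [FrolicherSpace Y] where
  hom : SmoothMap X Y
  inv : SmoothMap Y X
  inv_hom : ∀ x, inv (hom x) = x
  hom_inv : ∀ y, hom (inv y) = y

/-- The algebra `C^∞(X)` of functions on a Frölicher space `X`. -/
def CInfty (X : Type u) [FrolicherSpace X] : Subalgebra ℝ (X → ℝ) where
  carrier := functions
  mul_mem' {f g} hf hg := (mem_functions_iff _).2 fun c hc =>
    ((mem_functions_iff f).1 hf c hc).mul ((mem_functions_iff g).1 hg c hc)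
  add_mem' {f g} hf hg := (mem_functions_iff _).2 fun c hc =>
    ((mem_functions_iff f).1 hf c hc).add ((mem_functions_iff g).1 hg c hc)
  algebraMap_mem' _ := (mem_functions_iff _).2 fun _ _ => contDiff_const

namespace CInfty

variable {X : Type u} {Y : Type v} [FrolicherSpace X] [FrolicherSpace Y]

/-- The pull-back of functions along a smooth map, an algebra homomorphism. -/
def pullback (φ : SmoothMap X Y) : CInfty Y →ₐ[ℝ] CInfty X where
  toFun f := ⟨fun x => f.1 (φ x), (mem_functions_iff _).2 fun c hc =>
    (mem_functions_iff _).1 f.2 _ (φ.smooth c hc)⟩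
  map_one' := rfl
  map_mul' _ _ := rfl
  map_zero' := rfl
  map_add' _ _ := rfl
  commutes' _ := rfl

/-- An `n`-ary smooth operation applied to functions on `X`. -/
def op {n : ℕ} (h : (Fin n → ℝ) → ℝ) (hh : ContDiff ℝ ∞ h) (a : Fin n → CInfty X) : CInfty X :=
  ⟨fun x => h fun i => (a i).1 x, (mem_functions_iff _).2 fun c hc =>
    hh.comp (contDiff_pi.2 fun i => (mem_functions_iff _).1 (a i).2 c hc)⟩

end CInfty

/-! ## Smooth rings -/

/-- A `C^∞`-ring: a set on which every smooth function from `ℝⁿ` to `ℝ` acts as an `n`-ary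
operation, compatibly with projections and with composition. -/
class CInftyRing (A : Type) where
  op : ∀ {n : ℕ} (h : (Fin n → ℝ) → ℝ), ContDiff ℝ ∞ h → (Fin n → A) → A
  op_proj : ∀ {n : ℕ} (i : Fin n) (a : Fin n → A),
    op (fun x : Fin n → ℝ => x i) (contDiff_apply ℝ ℝ i) a = a i
  op_comp : ∀ {m n : ℕ} (h : (Fin m → ℝ) → ℝ) (hh : ContDiff ℝ ∞ h)
    (g : Fin m → (Fin n → ℝ) → ℝ) (hg : ∀ j, ContDiff ℝ ∞ (g j)) (a : Fin n → A),
    op (fun x => h fun j => g j x) (hh.comp (contDiff_pi.2 hg)) a =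
      op h hh fun j => op (g j) (hg j) a

/-- Homomorphisms of `C^∞`-rings. -/
@[ext] structure CInftyRingHom (A B : Type) [CInftyRing A] [CInftyRing B] where
  toFun : A → B
  map_op : ∀ {n : ℕ} (h : (Fin n → ℝ) → ℝ) (hh : ContDiff ℝ ∞ h) (a : Fin n → A),
    toFun (CInftyRing.op h hh a) = CInftyRing.op h hh fun i => toFun (a i)

section Hadamard

open MeasureTheory
open scoped Convolution

/-- The first order Taylor formula with smooth coefficients. -/
theorem exists_smooth_sub_eq_sum {n : ℕ} (h : (Fin n → ℝ) → ℝ) (hh : ContDiff ℝ ∞ h) :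
    ∃ G : Fin n → (Fin n → ℝ) × (Fin n → ℝ) → ℝ, (∀ i, ContDiff ℝ ∞ (G i)) ∧
      ∀ x y, h x - h y = ∑ i, (x i - y i) * G i (x, y) := by
  have hD : ContDiff ℝ ∞ (fderiv ℝ h) := hh.fderiv_right (by simp)
  let ρ : ContDiffBump (0 : ℝ) := ⟨2, 3, by norm_num, by norm_num⟩
  let f : ℝ → ℝ := Set.indicator (Set.Icc 0 1) fun _ => 1
  have hf : LocallyIntegrable f volume :=
    (IntegrableOn.integrable_indicator (by simp) measurableSet_Icc).locallyIntegrable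
  let g : Fin n → (Fin n → ℝ) × (Fin n → ℝ) → ℝ → ℝ := fun i p s =>
    ρ s * fderiv ℝ h (p.2 - s • (p.1 - p.2)) (Pi.single i 1)
  have hg : ∀ i, ContDiff ℝ ∞ (Function.uncurry (g i)) := fun i => by
    have h1 : ContDiff ℝ ∞ fun q : ((Fin n → ℝ) × (Fin n → ℝ)) × ℝ => ρ q.2 :=
      ρ.contDiff.comp contDiff_snd
    have h2 : ContDiff ℝ ∞ fun q : ((Fin n → ℝ) × (Fin n → ℝ)) × ℝ =>
        fderiv ℝ h (q.1.2 - q.2 • (q.1.1 - q.1.2)) := hD.comp (by fun_prop)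
    exact h1.mul (h2.clm_apply contDiff_const)
  refine ⟨fun i p => (f ⋆[ContinuousLinearMap.mul ℝ ℝ, volume] g i p) 0, fun i => ?_, ?_⟩
  · rw [← contDiffOn_univ]
    refine contDiffOn_convolution_right_with_param_comp (n := ⊤) (ContinuousLinearMap.mul ℝ ℝ)
      (v := fun _ => 0) contDiffOn_const isOpen_univ (isCompact_closedBall (0 : ℝ) 3)
      (fun p x _ hx => ?_) hf (hg i).contDiffOn
    have : ρ x = 0 := ρ.zero_of_le_dist (by
      simp only [Metric.mem_closedBall, not_le] at hx; exact hx.le)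
    simp [g, this]
  · intro x y
    have hconv : ∀ i, (f ⋆[ContinuousLinearMap.mul ℝ ℝ, volume] g i (x, y)) 0 =
        ∫ t in (0 : ℝ)..1, fderiv ℝ h (y + t • (x - y)) (Pi.single i 1) := fun i => by
      rw [intervalIntegral.integral_of_le zero_le_one, ← integral_Icc_eq_integral_Ioc,
        ← integral_indicator measurableSet_Icc]
      refine integral_congr_ae (Filter.Eventually.of_forall fun t => ?_)
      by_cases ht : t ∈ Set.Icc (0 : ℝ) 1
      · have : ρ (-t) = 1 := ρ.one_of_mem_closedBall (by
          simp only [Metric.mem_closedBall, dist_zero_right, norm_neg, Real.norm_eq_abs]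
          rw [abs_of_nonneg ht.1]; exact ht.2.trans (by norm_num [ρ]))
        simp [f, g, ht, this]
      · simp [f, ht]
    have hline : ∀ t : ℝ, HasDerivAt (fun t : ℝ => h (y + t • (x - y)))
        (fderiv ℝ h (y + t • (x - y)) (x - y)) t := fun t => by
      have hl : HasDerivAt (fun t : ℝ => y + t • (x - y)) (x - y) t := by
        simpa using ((hasDerivAt_id t).smul_const (x - y)).const_add y
      exact ((hh.differentiable (by simp)) _).hasFDerivAt.comp_hasDerivAt t hl
    have hcont : ∀ v, Continuous fun t : ℝ => fderiv ℝ h (y + t • (x - y)) v := fun v =>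
      (hD.continuous.comp (by fun_prop)).clm_apply continuous_const
    have hint := intervalIntegral.integral_eq_sub_of_hasDerivAt (fun t _ => hline t)
      ((hcont _).intervalIntegrable 0 1)
    simp only [one_smul, add_sub_cancel, zero_smul, add_zero] at hint
    rw [← hint]
    simp only [hconv, ← intervalIntegral.integral_const_mul]
    rw [← intervalIntegral.integral_finsetSum
      fun i _ => ((hcont _).intervalIntegrable 0 1).const_mul _]
    refine intervalIntegral.integral_congr fun t _ => ?_
    have hv : x - y = ∑ i, (x i - y i) • (Pi.single i 1 : Fin n → ℝ) := by
      simpa using pi_eq_sum_univ' (x - y)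
    change fderiv ℝ h (y + t • (x - y)) (x - y) = _
    conv_lhs => rw [hv, map_sum]
    rw [← hv]
    simp

end Hadamard

namespace CInfty

variable {M : Type} [FrolicherSpace M]

/-- Ideals are congruences for all smooth operations. -/
theorem mk_op_eq_mk_op (I : Ideal (CInfty M)) {n : ℕ} (h : (Fin n → ℝ) → ℝ)
    (hh : ContDiff ℝ ∞ h) (a b : Fin n → CInfty M)
    (hab : ∀ i, Ideal.Quotient.mk I (a i) = Ideal.Quotient.mk I (b i)) :
    Ideal.Quotient.mk I (op h hh a) = Ideal.Quotient.mk I (op h hh b) := by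
  obtain ⟨G, hG, hsum⟩ := exists_smooth_sub_eq_sum h hh
  rw [Ideal.Quotient.eq]
  have key : op h hh a - op h hh b = ∑ i, (a i - b i) *
      (⟨fun x => G i (fun j => (a j).1 x, fun j => (b j).1 x), (mem_functions_iff _).2 fun c hc =>
        (hG i).comp ((contDiff_pi.2 fun j => (mem_functions_iff _).1 (a j).2 c hc).prodMk
          (contDiff_pi.2 fun j => (mem_functions_iff _).1 (b j).2 c hc))⟩ : CInfty M) := by
    ext x
    simpa [op, Finset.sum_apply] using hsum (fun j => (a j).1 x) (fun j => (b j).1 x)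
  rw [key]
  exact Ideal.sum_mem _ fun i _ => I.mul_mem_right _ ((Ideal.Quotient.eq).1 (hab i))

/-- The `C^∞`-ring `C^∞(M) / I`, with the operations computed on representatives. -/
noncomputable instance instCInftyRingQuotient (I : Ideal (CInfty M)) :
    CInftyRing (CInfty M ⧸ I) where
  op h hh a := Ideal.Quotient.mk I (op h hh fun i => (a i).out)
  op_proj i a := Ideal.Quotient.mk_out (a i)
  op_comp h hh g hg a := mk_op_eq_mk_op I h hh (fun j => op (g j) (hg j) fun i => (a i).out) _
    fun _ => (Ideal.Quotient.mk_out _).symm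

end CInfty

/-! ## Weil algebras -/

/-- A Weil algebra, presented in the form `C^∞(ℝᵏ) / I` with the origin as its base point: the
quotient is a finite-dimensional local algebra. Its residue field is `ℝ`, through evaluation at
the origin. -/
structure WeilAlgebra where
  k : ℕ
  I : Ideal (CInfty (Fin k → ℝ))
  finite_quotient : Module.Finite ℝ (CInfty (Fin k → ℝ) ⧸ I)
  local_quotient : IsLocalRing (CInfty (Fin k → ℝ) ⧸ I)
  vanish : ∀ f ∈ I, f.1 0 = 0

/-- The ideal of `C^∞(M × N)` generated by an ideal of `C^∞(M)` and an ideal of `C^∞(N)`. For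
`M = ℝᵏ` and `N = ℝˡ`, the quotient by it is the coproduct of `C^∞`-rings
`(C^∞(ℝᵏ) / I) ⊗_∞ (C^∞(ℝˡ) / J)`. -/
def coprodIdeal {M N : Type} [FrolicherSpace M] [FrolicherSpace N] (I : Ideal (CInfty M))
    (J : Ideal (CInfty N)) : Ideal (CInfty (M × N)) :=
  I.map (CInfty.pullback (SmoothMap.fst : SmoothMap (M × N) M)) ⊔
    J.map (CInfty.pullback (SmoothMap.snd : SmoothMap (M × N) N))

/-! ## Weil prolongation -/

/-- The relation `f ≡ g mod I` on smooth maps from a pointed space `M` to `X`. -/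
def prolongationSetoid (X : Type u) [FrolicherSpace X] {M : Type} [FrolicherSpace M] [Zero M]
    (I : Ideal (CInfty M)) : Setoid (SmoothMap M X) where
  r f g := f 0 = g 0 ∧ ∀ χ : CInfty X, CInfty.pullback f χ - CInfty.pullback g χ ∈ I
  iseqv :=
    { refl := fun f => ⟨rfl, fun χ => by simp⟩
      symm := by
        rintro f g ⟨h0, h⟩
        exact ⟨h0.symm, fun χ => by simpa using I.neg_mem (h χ)⟩
      trans := by
        rintro f g k ⟨h0, h⟩ ⟨h0', h'⟩
        exact ⟨h0.trans h0', fun χ => by simpa using I.add_mem (h χ) (h' χ)⟩ }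

/-- The Weil prolongation `X ⊗ (C^∞(M) / I)`, where `M = ℝᵏ` or `M = ℝᵏ × ℝˡ`, pointed by the
origin. -/
def Prolongation (X : Type u) [FrolicherSpace X] {M : Type} [FrolicherSpace M] [Zero M]
    (I : Ideal (CInfty M)) : Type u :=
  Quotient (prolongationSetoid X I)

namespace Prolongation

variable {X : Type u} {Y : Type v} [FrolicherSpace X] [FrolicherSpace Y]
  {M : Type} [FrolicherSpace M] [Zero M]

/-- The class of a smooth map. -/
def mk (I : Ideal (CInfty M)) (f : SmoothMap M X) : Prolongation X I :=
  Quotient.mk (prolongationSetoid X I) f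

/-- The map `χ ⊗ W : X ⊗ W → ℝ ⊗ W = W` for a function `χ` on `X`. -/
def evalFunction (I : Ideal (CInfty M)) (χ : CInfty X) (q : Prolongation X I) : CInfty M ⧸ I :=
  Quotient.lift (fun f : SmoothMap M X => Ideal.Quotient.mk I (CInfty.pullback f χ))
    (by rintro f g ⟨_, h⟩; exact Ideal.Quotient.eq.2 (h χ)) q

/-- The initial structure for the maps `χ ⊗ W : X ⊗ W → W`, where the finite-dimensional vector
space `W` has the structure generated by its linear forms. -/
instance instFrolicherSpace (I : Ideal (CInfty M)) : FrolicherSpace (Prolongation X I) :=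
  FrolicherSpace.ofFunctions
    {ψ | ∃ (χ : CInfty X) (l : (CInfty M ⧸ I) →ₗ[ℝ] ℝ), ψ = fun q => l (evalFunction I χ q)}

/-- The smooth map `φ ⊗ W : X ⊗ W → Y ⊗ W`. -/
def map (I : Ideal (CInfty M)) (φ : SmoothMap X Y) :
    SmoothMap (Prolongation X I) (Prolongation Y I) where
  toFun := Quotient.map (sa := prolongationSetoid X I) (sb := prolongationSetoid Y I)
    (fun f : SmoothMap M X => φ.comp f) <| by
      rintro f g ⟨h0, h⟩
      exact ⟨congrArg φ h0, fun χ => h (CInfty.pullback φ χ)⟩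
  smooth c hc := by
    rintro _ ⟨χ, l, rfl⟩
    have := hc _ ⟨CInfty.pullback φ χ, l, rfl⟩
    convert this using 1
    funext t
    change l (evalFunction I χ (Quotient.map _ _ (c t))) = l (evalFunction I _ (c t))
    generalize c t = q
    exact Quotient.inductionOn (s := prolongationSetoid X I) q fun _ => rfl

theorem map_mk (I : Ideal (CInfty M)) (φ : SmoothMap X Y) (f : SmoothMap M X) :
    map I φ (mk I f) = mk I (φ.comp f) := rfl

end Prolongation

/-! ## Weil exponentiability -/

/-- `X` is Weil-exponentiable if `(X ⊗ (W₁ ⊗_∞ W₂)) ^ Y = (X ⊗ W₁) ^ Y ⊗ W₂` for all Frölicher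
spaces `Y` and all Weil algebras `W₁`, `W₂`. The equality is an isomorphism `Θ` of Frölicher
spaces that is the canonical one: at each point of `Y` it is given on representatives by sending
the class of `F : ℝᵏ × ℝˡ → X` to the class of `z ↦ [F(·, z)]`, `ℝˡ → X ⊗ W₁`. -/
def IsWeilExponentiable (X : Type u) [FrolicherSpace X] : Prop :=
  ∀ (Y : Type u) [FrolicherSpace Y] (W₁ W₂ : WeilAlgebra),
    ∃ Θ : FrolicherIso (SmoothMap Y (Prolongation X (coprodIdeal W₁.I W₂.I)))
        (Prolongation (SmoothMap Y (Prolongation X W₁.I)) W₂.I),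
      ∀ (h : SmoothMap Y (Prolongation X (coprodIdeal W₁.I W₂.I))) (y : Y)
        (F : SmoothMap ((Fin W₁.k → ℝ) × (Fin W₂.k → ℝ)) X)
        (g : SmoothMap (Fin W₂.k → ℝ) (Prolongation X W₁.I)),
        h y = Prolongation.mk _ F → (∀ z, g z = Prolongation.mk _ (F.slice z)) →
          Prolongation.map W₂.I (SmoothMap.evalAt y) (Θ.hom h) = Prolongation.mk _ g

/-! ## The categories -/

/-- The category `FS` of Frölicher spaces and smooth maps. -/
structure FS where
  of ::
  carrier : Type u
  [str : FrolicherSpace carrier]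

attribute [instance] FS.str

instance : Category FS.{u} where
  Hom X Y := SmoothMap X.carrier Y.carrier
  id X := SmoothMap.id X.carrier
  comp f g := SmoothMap.comp g f

/-- The underlying-set functor. -/
def FS.toSets : FS.{u} ⥤ Type u where
  obj X := X.carrier
  map f := ↾(fun x => SmoothMap.toFun f x)

/-- The full subcategory `FS_WE` of Weil-exponentiable Frölicher spaces. -/
abbrev FSWE := ObjectProperty.FullSubcategory fun X : FS.{u} => IsWeilExponentiable X.carrier

/-- The objects `C^∞(ℝⁿ) ⊗_∞ W` of the category `D`. -/
structure CahiersObj where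
  n : ℕ
  W : WeilAlgebra

namespace CahiersObj

/-- The `C^∞`-ring `C^∞(ℝⁿ) ⊗_∞ (C^∞(ℝᵏ) / I) = C^∞(ℝⁿ × ℝᵏ) / (I)`. -/
abbrev ideal (C : CahiersObj) : Ideal (CInfty ((Fin C.n → ℝ) × (Fin C.W.k → ℝ))) :=
  coprodIdeal (⊥ : Ideal (CInfty (Fin C.n → ℝ))) C.W.I

/-- The underlying `C^∞`-ring of an object of `D`. -/
abbrev ring (C : CahiersObj) : Type := CInfty ((Fin C.n → ℝ) × (Fin C.W.k → ℝ)) ⧸ C.ideal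

/-- `D` as a full subcategory of the category of `C^∞`-rings. -/
instance : Category CahiersObj where
  Hom C C' := CInftyRingHom C.ring C'.ring
  id C := ⟨fun a => a, fun _ _ _ => rfl⟩
  comp f g := ⟨fun a => g.toFun (f.toFun a), fun h hh a => by rw [f.map_op, g.map_op]⟩

end CahiersObj

/-! ## The functor `J` -/

/-- The prolongation `X ⊗ C = C^∞(ℝⁿ, X) ⊗ W` for `C = C^∞(ℝⁿ) ⊗_∞ W`. -/
abbrev Extended (X : Type u) [FrolicherSpace X] (C : CahiersObj) : Type u :=
  Prolongation (SmoothMap (Fin C.n → ℝ) X) C.W.I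

namespace Extended

variable {X Y Z : Type u} [FrolicherSpace X] [FrolicherSpace Y] [FrolicherSpace Z]

/-- The functoriality of `X ⊗ C` in `X`. -/
def map (C : CahiersObj) (φ : SmoothMap X Y) : SmoothMap (Extended X C) (Extended Y C) :=
  Prolongation.map C.W.I (SmoothMap.postcomp (Fin C.n → ℝ) φ)

theorem map_id (C : CahiersObj) (q : Extended X C) : map C (SmoothMap.id X) q = q :=
  Quotient.inductionOn (s := prolongationSetoid _ C.W.I) q fun _ => rfl

theorem map_comp (C : CahiersObj) (ψ : SmoothMap Y Z) (φ : SmoothMap X Y) (q : Extended X C) :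
    map C (ψ.comp φ) q = map C ψ (map C φ q) :=
  Quotient.inductionOn (s := prolongationSetoid _ C.W.I) q fun _ => rfl

end Extended

/-- Functoriality of `X ⊗ C` in the variable `C`, for Weil-exponentiable `X`, jointly with the
functoriality in `X`. A morphism `α : C → C'` of `C^∞`-rings is induced by smooth maps
`φ : ℝⁿ' × ℝᵏ' → ℝⁿ × ℝᵏ`, and `X ⊗ α` is substitution of any such `φ` in representatives. -/
structure ProlongationFunctoriality where
  act : ∀ (X : FSWE.{u}) {C C' : CahiersObj}, (C ⟶ C') →
    SmoothMap (Extended X.obj.carrier C) (Extended X.obj.carrier C')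
  act_mk : ∀ (X : FSWE.{u}) {C C' : CahiersObj} (α : C ⟶ C')
    (φ : SmoothMap ((Fin C'.n → ℝ) × (Fin C'.W.k → ℝ)) ((Fin C.n → ℝ) × (Fin C.W.k → ℝ)))
    (f : SmoothMap (Fin C.W.k → ℝ) (SmoothMap (Fin C.n → ℝ) X.obj.carrier))
    (g : SmoothMap (Fin C'.W.k → ℝ) (SmoothMap (Fin C'.n → ℝ) X.obj.carrier)),
    (∀ a, α.toFun (Ideal.Quotient.mk C.ideal a) =
      Ideal.Quotient.mk C'.ideal (CInfty.pullback φ a)) →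
    (∀ z x, g z x = f (φ (x, z)).2 (φ (x, z)).1) →
    act X α (Prolongation.mk _ f) = Prolongation.mk _ g
  act_id : ∀ (X : FSWE.{u}) (C : CahiersObj) (q : Extended X.obj.carrier C), act X (𝟙 C) q = q
  act_comp : ∀ (X : FSWE.{u}) {C C' C'' : CahiersObj} (α : C ⟶ C') (β : C' ⟶ C'')
    (q : Extended X.obj.carrier C), act X (α ≫ β) q = act X β (act X α q)
  act_natural : ∀ {X Y : FSWE.{u}} (φ : X ⟶ Y) {C C' : CahiersObj} (α : C ⟶ C')
    (q : Extended X.obj.carrier C),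
    act Y α (Extended.map C φ.hom q) = Extended.map C' φ.hom (act X α q)

namespace ProlongationFunctoriality

/-- The bifunctor `(X, C) ↦ X ⊗ C`. -/
def bifunctor (T : ProlongationFunctoriality.{u}) : FSWE.{u} × CahiersObj ⥤ FS.{u} where
  obj p := FS.of (Extended p.1.obj.carrier p.2)
  map {p q} m := SmoothMap.comp (Extended.map q.2 m.1.hom) (T.act p.1 m.2)
  map_id p := by
    apply SmoothMap.ext
    intro q
    exact (Extended.map_id p.2 _).trans (T.act_id p.1 p.2 q)
  map_comp {p q r} m m' := by
    apply SmoothMap.ext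
    intro x
    change Extended.map r.2 (SmoothMap.comp m'.1.hom m.1.hom) (T.act p.1 (m.2 ≫ m'.2) x) =
      Extended.map r.2 m'.1.hom (T.act q.1 m'.2 (Extended.map q.2 m.1.hom (T.act p.1 m.2 x)))
    rw [T.act_comp, Extended.map_comp, T.act_natural]

/-- The functor `J : FS_WE → Sets^D`, the exponential adjoint of the composite of the bifunctor
`⊗` with the underlying-set functor. -/
def J (T : ProlongationFunctoriality.{u}) : FSWE.{u} ⥤ CahiersObj ⥤ Type u :=
  Functor.curry.obj (T.bifunctor ⋙ FS.toSets)

end ProlongationFunctoriality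

/-- The product of Weil-exponentiable spaces, once it is known to be Weil-exponentiable. -/
def FSWE.prod (X Y : FSWE.{u}) (h : IsWeilExponentiable (X.obj.carrier × Y.obj.carrier)) :
    FSWE.{u} := ⟨FS.of (X.obj.carrier × Y.obj.carrier), h⟩

/-- The first projection of the product. -/
def FSWE.fst (X Y : FSWE.{u}) (h : IsWeilExponentiable (X.obj.carrier × Y.obj.carrier)) :
    FSWE.prod X Y h ⟶ X :=
  ObjectProperty.homMk (X := FSWE.prod X Y h)
    (SmoothMap.fst : SmoothMap (X.obj.carrier × Y.obj.carrier) X.obj.carrier)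

/-- The second projection of the product. -/
def FSWE.snd (X Y : FSWE.{u}) (h : IsWeilExponentiable (X.obj.carrier × Y.obj.carrier)) :
    FSWE.prod X Y h ⟶ Y :=
  ObjectProperty.homMk (X := FSWE.prod X Y h)
    (SmoothMap.snd : SmoothMap (X.obj.carrier × Y.obj.carrier) Y.obj.carrier)

/-! Everything rests on one fact: Weil prolongation preserves products, `(X × Y) ⊗ W ≅ (X ⊗ W) × (Y
⊗ W)` as Frölicher spaces (`IsWeilIdeal.prodIso`). Exponentials preserve products as well, so the
isomorphisms for `X` and `Y` multiply to one for `X × Y`, whose canonical form is checked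
componentwise. For the same reason `X ⊗ C = C^∞(ℝⁿ, X) ⊗ W` preserves products in `X`. The
assumption on functoriality in `C` serves only to make `J` a functor.

The inverse has to send `([f], [g])` to `[(f, g)]`. To see that this is well defined, put `H(x, y) =
χ(f x, g y)` for a function `χ` on `X × Y`. Some power of the ideal of functions vanishing at the
origin lies in `I`, so Taylor expansion gives `H = ∑ bᵢ(x) cᵢ(y)` modulo `I` in the first variable.
The class of `H` on the diagonal is therefore `∑ eₚ · [z ↦ eₚ*[H(·, z)]]` for a basis `eₚ` of `W`
(`mk_restrictDiag_eq`), which depends on `f` and `g` only through their classes.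

Smoothness of the inverse is harder. For curves `c`, `d` of classes, the formula contains `c t` in
the coefficient function and `d t` in the point, no smooth choice of representatives is available,
and curves in a prolongation are tested against one fixed function at a time. What is needed is
joint smoothness of `(t, s) ↦ l((B(·, s) ⊗ W)(c t))`. By `contDiff_of_smooth_sums` it suffices that
`ℓ¹`-weighted sums of `s`-derivatives are smooth in `t`. Such a sum is a functional `Λ` on `C^∞(ℝ)`,
and it commutes with `l`, so it yields `l((ΛB ⊗ W)(c t))`, which is smooth by the definition of the
initial structure.

The criterion comes from uniform boundedness on `ℓ¹` together with a Fourier argument: a continuous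
function with locally bounded pure derivatives along the axes is smooth. The Fourier argument also
yields Boman's theorem, and the `ℓ¹` criterion shows that curves in an exponential have smooth
adjoints. -/

/-! ### Smoothness from decay of the Fourier transform -/

section FourierCriterion

open MeasureTheory Real FourierTransform
open scoped RealInnerProductSpace

/-- The Fourier transform of a line derivative. -/
theorem fourier_of_hasLineDerivAt {V : Type*} [NormedAddCommGroup V] [InnerProductSpace ℝ V]
    [FiniteDimensional ℝ V] [MeasurableSpace V] [BorelSpace V] {f f' : V → ℂ} {v : V}
    (hf : Integrable f) (hf' : Integrable f') (h : ∀ x, HasLineDerivAt ℝ f (f' x) x v) (w : V) :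
    𝓕 f' w = (2 * π * Complex.I * ⟪v, w⟫) * 𝓕 f w := by
  have hL : ∀ F : V → ℂ, 𝓕 F w = ∫ x, ((𝐞 (-(innerSL ℝ (E := V) x w)) : Circle) : ℂ) * F x :=
    fun F => rfl
  have hi : ∀ F : V → ℂ, Integrable F →
      Integrable fun x => ((𝐞 (-(innerSL ℝ (E := V) x w)) : Circle) : ℂ) * F x := fun F hF => by
    exact (VectorFourier.fourierIntegral_convergent_iff Real.continuous_fourierChar
      (L := (innerSL ℝ (E := V)).toLinearMap₁₂) (by
        exact ((innerSL ℝ (E := V)).continuous₂)) w).2 hF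
  rw [hL, hL]
  let g (x : V) : ℂ := 𝐞 (-(innerSL ℝ (E := V) x w))
  have hd : Differentiable ℝ g := differentiable_fourierChar_neg_bilinear_left (innerSL ℝ) w
  have A x : fderiv ℝ g x v = - 2 * π * Complex.I * (innerSL ℝ v w : ℝ) * g x :=
    fderiv_fourierChar_neg_bilinear_left_apply _ _ _ _
  -- Integration by parts moves the line derivative onto the character.
  have key := integral_bilinear_hasLineDerivAt_right_eq_neg_left_of_integrable
    (μ := (volume : Measure V)) (f := g) (f' := fun x => fderiv ℝ g x v) (g := f) (g' := f')
    (v := v) (B := ContinuousLinearMap.mul ℝ ℂ) ?_ ?_ ?_ ?_ ?_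
  · simp only [ContinuousLinearMap.mul_apply'] at key
    rw [key, ← integral_neg, ← integral_const_mul]
    refine integral_congr_ae (Filter.Eventually.of_forall fun x => ?_)
    simp only [A]
    simp only [innerSL_apply_apply, g]
    ring
  · simp only [ContinuousLinearMap.mul_apply', A]
    convert! (hi f hf).const_mul (- 2 * π * Complex.I * (innerSL ℝ v w : ℝ)) using 2 with x
    simp only [g]; ring
  · exact hi _ hf'
  · exact hi _ hf
  · exact fun x _ => (hd x).hasFDerivAt.hasLineDerivAt v
  · exact fun x _ => h x

/-- The largest coordinate controls the norm, so decay in each coordinate gives decay in `‖w‖`. The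
summand `1` covers `d = n = 0`, where the sum is empty but `‖w‖ ^ 0 = 1`. -/
theorem norm_pow_le_sum_pow {d : ℕ} (w : EuclideanSpace ℝ (Fin d)) (n : ℕ) :
    ‖w‖ ^ n ≤ (d : ℝ) ^ n * (1 + ∑ i, |w i| ^ n) := by
  rcases isEmpty_or_nonempty (Fin d) with h | h
  · have : w = 0 := Subsingleton.elim _ _
    subst this
    rcases Nat.eq_zero_or_pos n with rfl | hn
    · simp
    · simp only [norm_zero, zero_pow hn.ne', Finset.univ_eq_empty, Finset.sum_empty]
      positivity
  · obtain ⟨j, hj⟩ := Finite.exists_max fun i => |w i|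
    have h1 : ‖w‖ ≤ d * |w j| := by
      have : ‖w‖ ≤ ∑ i, |w i| := by
        conv_lhs => rw [← (EuclideanSpace.basisFun (Fin d) ℝ).sum_repr w]
        refine (norm_sum_le _ _).trans (Finset.sum_le_sum fun i _ => ?_)
        simp [norm_smul]
      refine this.trans ((Finset.sum_le_sum fun i _ => hj i).trans ?_)
      simp
    calc ‖w‖ ^ n ≤ (d * |w j|) ^ n := by gcongr
      _ = d ^ n * |w j| ^ n := mul_pow _ _ _
      _ ≤ d ^ n * (1 + ∑ i, |w i| ^ n) := by
        have : |w j| ^ n ≤ ∑ i, |w i| ^ n :=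
          Finset.single_le_sum (f := fun i => |w i| ^ n) (fun i _ => by positivity)
            (Finset.mem_univ j)
        gcongr
        linarith

/-- A continuous integrable function whose iterated line derivatives along the coordinate
directions exist and are integrable is smooth. -/
theorem contDiff_of_integrable_lineDerivs {d : ℕ} {f : EuclideanSpace ℝ (Fin d) → ℂ}
    (hf : Continuous f) (D : Fin d → ℕ → EuclideanSpace ℝ (Fin d) → ℂ) (hfi : Integrable f)
    (h0 : ∀ i, D i 0 = f)
    (hD : ∀ i n x, HasLineDerivAt ℝ (D i n) (D i (n + 1) x) x (EuclideanSpace.single i 1))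
    (hint : ∀ i n, Integrable (D i n)) : ContDiff ℝ ∞ f := by
  have hF : ∀ i n w, 𝓕 (D i n) w = (2 * π * Complex.I * (w i : ℝ)) ^ n * 𝓕 f w := by
    intro i n w
    induction n with
    | zero => simp [h0]
    | succ n ih =>
      rw [fourier_of_hasLineDerivAt (hint i n) (hint i (n + 1)) (hD i n), ih]
      simp [EuclideanSpace.inner_single_left]
      ring
  have hb : ∀ (g : EuclideanSpace ℝ (Fin d) → ℂ) w, ‖𝓕 g w‖ ≤ ∫ x, ‖g x‖ := fun g w =>
    VectorFourier.norm_fourierIntegral_le_integral_norm _ _ _ _ _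
  have hpow : ∀ n, ∃ C, ∀ w, ‖w‖ ^ n * ‖𝓕 f w‖ ≤ C := by
    intro n
    refine ⟨d ^ n * ((∫ x, ‖f x‖) + ∑ i, ∫ x, ‖D i n x‖), fun w => ?_⟩
    have h1 : ∀ i, |w i| ^ n * ‖𝓕 f w‖ ≤ ∫ x, ‖D i n x‖ := fun i => by
      refine le_trans ?_ (hb (D i n) w)
      rw [hF, norm_mul, norm_pow]
      gcongr
      simp only [Complex.norm_mul, Complex.norm_real, Complex.norm_I, Real.norm_eq_abs,
        Complex.norm_ofNat, abs_of_pos Real.pi_pos]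
      have := Real.pi_gt_three
      nlinarith [abs_nonneg (w i)]
    calc ‖w‖ ^ n * ‖𝓕 f w‖ ≤ (d : ℝ) ^ n * (1 + ∑ i, |w i| ^ n) * ‖𝓕 f w‖ := by
          gcongr; exact norm_pow_le_sum_pow w n
      _ = (d : ℝ) ^ n * (‖𝓕 f w‖ + ∑ i, |w i| ^ n * ‖𝓕 f w‖) := by
          rw [← Finset.sum_mul]; ring
      _ ≤ _ := by
          gcongr with i
          · exact hb f w
          · exact h1 i
  have hcont : Continuous (𝓕 f) :=
    VectorFourier.fourierIntegral_continuous Real.continuous_fourierChar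
      (by exact continuous_inner) hfi
  have hmom : ∀ n : ℕ, Integrable fun w => ‖w‖ ^ n * ‖𝓕 f w‖ := by
    intro n
    choose C hC using hpow
    -- The exponent `d + 1` exceeds the dimension. The constant below is the binomial expansion of
    -- `(1 + ‖w‖) ^ (d + 1)`, each term being bounded by `hpow`.
    have hi : Integrable fun w : EuclideanSpace ℝ (Fin d) => (1 + ‖w‖) ^ (-((d + 1 : ℕ) : ℝ)) :=
      integrable_one_add_norm (by simp)
    refine (hi.const_mul (∑ k ∈ Finset.range (d + 2), (d + 1).choose k * C (n + k))).mono'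
      (by fun_prop) (Filter.Eventually.of_forall fun w => ?_)
    have hpos : (0 : ℝ) < (1 + ‖w‖) ^ (d + 1) := by positivity
    rw [Real.rpow_neg (by positivity), Real.rpow_natCast, ← div_eq_mul_inv, le_div_iff₀ hpos,
      Real.norm_of_nonneg (by positivity), add_comm 1, add_pow, Finset.mul_sum]
    refine Finset.sum_le_sum fun k _ => ?_
    have := hC (n + k) w
    have hc : (0 : ℝ) ≤ (d + 1).choose k := by positivity
    calc _ = ((d + 1).choose k : ℝ) * (‖w‖ ^ (n + k) * ‖𝓕 f w‖) := by
          rw [pow_add]; simp; ring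
      _ ≤ _ := mul_le_mul_of_nonneg_left this hc
  have hint' : Integrable (𝓕 f) := by
    have := hmom 0
    simp only [pow_zero, one_mul] at this
    exact (integrable_norm_iff hcont.aestronglyMeasurable).1 this
  -- By Fourier inversion `f` is itself a transform, of a function with all moments integrable.
  rw [← hf.fourierInv_fourier_eq hfi hint']
  have : 𝓕⁻ (𝓕 f) = fun x => 𝓕 (𝓕 f) (-x) := by
    ext x; exact fourierInv_eq_fourier_neg _ _
  rw [this]
  exact (contDiff_fourier (N := ⊤) fun n _ => hmom n).comp contDiff_neg

end FourierCriterion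

/-! ### Derivatives along lines and the coordinate criterion for smoothness -/

section LineDerivatives

open MeasureTheory Topology Filter

variable {E : Type*} [NormedAddCommGroup E] [NormedSpace ℝ E]

/-- The `n`-th derivative of `f` at `x` along the line in direction `v`. -/
noncomputable def lineIter (f : E → ℝ) (v : E) (n : ℕ) (x : E) : ℝ :=
  iteratedDeriv n (fun t : ℝ => f (x + t • v)) 0

/-- Smoothness along all lines in direction `v`, with locally bounded derivatives. -/
structure LocBddLineDerivs (f : E → ℝ) (v : E) : Prop where
  smooth : ∀ x, ContDiff ℝ ∞ fun t : ℝ => f (x + t • v)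
  bdd : ∀ n x, ∃ C, ∀ᶠ y in 𝓝 x, |lineIter f v n y| ≤ C

theorem lineIter_add_smul (f : E → ℝ) (v : E) (n : ℕ) (x : E) (s : ℝ) :
    lineIter f v n (x + s • v) = iteratedDeriv n (fun t : ℝ => f (x + t • v)) s := by
  have := congrFun (iteratedDeriv_comp_const_add n (fun t : ℝ => f (x + t • v)) s) 0
  simp only [add_zero] at this
  rw [← this, lineIter]
  simp only [add_smul, add_assoc]

@[simp] theorem lineIter_zero (f : E → ℝ) (v : E) : lineIter f v 0 = f := by
  ext x; simp [lineIter]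

theorem hasLineDerivAt_lineIter {f : E → ℝ} {v : E}
    (h : ∀ x, ContDiff ℝ ∞ fun t : ℝ => f (x + t • v)) (n : ℕ) (x : E) :
    HasLineDerivAt ℝ (lineIter f v n) (lineIter f v (n + 1) x) x v := by
  have h1 : (fun t : ℝ => lineIter f v n (x + t • v)) =
      iteratedDeriv n (fun t : ℝ => f (x + t • v)) := funext fun t => lineIter_add_smul f v n x t
  rw [HasLineDerivAt, h1, lineIter, iteratedDeriv_succ]
  exact (((h x).differentiable_iteratedDeriv n (by exact_mod_cast ENat.natCast_lt_top n))
    0).hasDerivAt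

theorem contDiff_lineIter {f : E → ℝ} (hf : ContDiff ℝ ∞ f) (v : E) (n : ℕ) :
    ContDiff ℝ ∞ (lineIter f v n) := by
  induction n generalizing f with
  | zero => simpa using hf
  | succ n ih =>
    -- Differentiating once first keeps the induction among smooth functions on `E`.
    have h1 : lineIter f v (n + 1) = lineIter (fun y => fderiv ℝ f y v) v n := by
      ext x
      simp only [lineIter, iteratedDeriv_succ']
      congr 1
      ext t
      have hl : HasDerivAt (fun t : ℝ => x + t • v) v t := by
        simpa using ((hasDerivAt_id t).smul_const v).const_add x
      exact (((hf.differentiable (by simp)) _).hasFDerivAt.comp_hasDerivAt t hl).deriv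
    rw [h1]
    exact ih ((hf.fderiv_right (m := ∞) (by simp)).clm_apply contDiff_const)

theorem LocBddLineDerivs.of_contDiff {f : E → ℝ} (hf : ContDiff ℝ ∞ f) (v : E) :
    LocBddLineDerivs f v where
  smooth x := hf.comp (by fun_prop)
  bdd n x := ⟨|lineIter f v n x| + 1, by
    have h := (contDiff_lineIter hf v n).continuous.abs.continuousAt (x := x)
    exact (h.eventually (gt_mem_nhds (lt_add_one _))).mono fun y hy => hy.le⟩

/-- Leibniz's formula; it lets a function be cut off by a bump without losing the bounds. -/
theorem LocBddLineDerivs.mul {f g : E → ℝ} {v : E} (hf : LocBddLineDerivs f v)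
    (hg : LocBddLineDerivs g v) : LocBddLineDerivs (fun x => f x * g x) v where
  smooth x := (hf.smooth x).mul (hg.smooth x)
  bdd n x := by
    choose A hA using fun k => hf.bdd k x
    choose B hB using fun k => hg.bdd k x
    refine ⟨∑ i ∈ Finset.range (n + 1), n.choose i * A i * B (n - i), ?_⟩
    have h1 : ∀ᶠ y in 𝓝 x, ∀ i ∈ Finset.range (n + 1),
        |lineIter f v i y| ≤ A i ∧ |lineIter g v (n - i) y| ≤ B (n - i) :=
      (Finset.eventually_all _).2 fun i _ => (hA i).and (hB (n - i))
    filter_upwards [h1] with y hy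
    have hfy : ContDiffAt ℝ n (fun t : ℝ => f (y + t • v)) 0 :=
      ((hf.smooth y).of_le (by exact_mod_cast le_top)).contDiffAt
    have hgy : ContDiffAt ℝ n (fun t : ℝ => g (y + t • v)) 0 :=
      ((hg.smooth y).of_le (by exact_mod_cast le_top)).contDiffAt
    rw [lineIter, iteratedDeriv_fun_mul hfy hgy]
    refine (Finset.abs_sum_le_sum_abs _ _).trans (Finset.sum_le_sum fun i hi => ?_)
    obtain ⟨h1, h2⟩ := hy i hi
    rw [abs_mul, abs_mul, Nat.abs_cast]
    exact mul_le_mul (mul_le_mul_of_nonneg_left h1 (by positivity)) h2 (abs_nonneg _)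
      (mul_nonneg (by positivity) ((abs_nonneg _).trans h1))

theorem lineIter_eq_zero_of_notMem_tsupport {f : E → ℝ} {v : E} {n : ℕ} {x : E}
    (hx : x ∉ tsupport f) : lineIter f v n x = 0 := by
  have h1 : ∀ᶠ y in 𝓝 x, f y = 0 := notMem_tsupport_iff_eventuallyEq.1 hx
  have h2 : Tendsto (fun t : ℝ => x + t • v) (𝓝 0) (𝓝 x) := by
    have : Continuous fun t : ℝ => x + t • v := by fun_prop
    simpa using this.tendsto 0
  have h3 : (fun t : ℝ => f (x + t • v)) =ᶠ[𝓝 0] fun _ => 0 := h2.eventually h1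
  rw [lineIter, h3.iteratedDeriv_eq]
  simp

theorem LocBddLineDerivs.exists_bound {f : E → ℝ} {v : E} (hf : LocBddLineDerivs f v)
    (hc : HasCompactSupport f) (n : ℕ) : ∃ C, ∀ x, |lineIter f v n x| ≤ C := by
  have : ∃ C, ∀ x ∈ tsupport f, |lineIter f v n x| ≤ C := by
    refine IsCompact.induction_on (p := fun s => ∃ C, ∀ x ∈ s, |lineIter f v n x| ≤ C) hc
      ⟨0, by simp⟩ (fun s t hst ⟨C, hC⟩ => ⟨C, fun x hx => hC x (hst hx)⟩) ?_ ?_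
    · rintro s t ⟨C, hC⟩ ⟨C', hC'⟩
      refine ⟨max C C', ?_⟩
      rintro x (hx | hx)
      · exact (hC x hx).trans (le_max_left _ _)
      · exact (hC' x hx).trans (le_max_right _ _)
    · intro x _
      obtain ⟨C, hC⟩ := hf.bdd n x
      exact ⟨_, mem_nhdsWithin_of_mem_nhds hC, C, fun y hy => hy⟩
  obtain ⟨C, hC⟩ := this
  refine ⟨max C 0, fun x => ?_⟩
  by_cases hx : x ∈ tsupport f
  · exact (hC x hx).trans (le_max_left _ _)
  · rw [lineIter_eq_zero_of_notMem_tsupport hx]; simp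

/-- Line derivatives need not be continuous here, but they are pointwise limits of difference
quotients with step `1 / (k + 1)`. Measurability and boundedness are enough for integrability on a
compact support. -/
theorem measurable_lineIter [MeasurableSpace E] [BorelSpace E] {f : E → ℝ} {v : E}
    (hf : Continuous f) (h : ∀ x, ContDiff ℝ ∞ fun t : ℝ => f (x + t • v)) (n : ℕ) :
    Measurable (lineIter f v n) := by
  induction n with
  | zero => simpa using hf.measurable
  | succ n ih =>
    have hlim : ∀ x, Tendsto (fun k : ℕ => ((k : ℝ) + 1) *
        (lineIter f v n (x + (1 / ((k : ℝ) + 1)) • v) - lineIter f v n x)) atTop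
        (𝓝 (lineIter f v (n + 1) x)) := fun x => by
      have h1 := hasLineDerivAt_iff_tendsto_slope_zero.1 (hasLineDerivAt_lineIter h n x)
      have h2 : Tendsto (fun k : ℕ => 1 / ((k : ℝ) + 1)) atTop (𝓝[≠] 0) :=
        tendsto_nhdsWithin_iff.2 ⟨tendsto_one_div_add_atTop_nhds_zero_nat,
          Eventually.of_forall fun k => by
            simp only [Set.mem_compl_iff, Set.mem_singleton_iff]; positivity⟩
      simpa [Function.comp_def] using h1.comp h2
    refine measurable_of_tendsto_metrizable (fun k => ?_) (tendsto_pi_nhds.2 hlim)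
    exact ((ih.comp (by fun_prop : Measurable fun x : E => x + (1 / ((k : ℝ) + 1)) • v)).sub
      ih).const_mul _

/-- A continuous function all of whose iterated derivatives along each coordinate direction exist
and are locally bounded is smooth. -/
theorem contDiff_of_locBddLineDerivs {d : ℕ} {f : EuclideanSpace ℝ (Fin d) → ℝ}
    (hf : Continuous f) (h : ∀ i, LocBddLineDerivs f (EuclideanSpace.single i 1)) :
    ContDiff ℝ ∞ f := by
  rw [contDiff_iff_contDiffAt]
  intro x
  -- Smoothness is local, so `f` is replaced by a compactly supported function that agrees with it
  -- near `x`.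
  let ρ : ContDiffBump x := ⟨1, 2, by norm_num, by norm_num⟩
  let F : EuclideanSpace ℝ (Fin d) → ℝ := fun y => ρ y * f y
  have hFc : Continuous F := ρ.continuous.mul hf
  have hFs : HasCompactSupport F := ρ.hasCompactSupport.mul_right
  have hF : ∀ i, LocBddLineDerivs F (EuclideanSpace.single i 1) := fun i =>
    (LocBddLineDerivs.of_contDiff ρ.contDiff _).mul (h i)
  have hint : ∀ i n, Integrable (lineIter F (EuclideanSpace.single i 1) n) := fun i n => by
    obtain ⟨C, hC⟩ := (hF i).exists_bound hFs n
    have h1 : IntegrableOn (lineIter F (EuclideanSpace.single i 1) n) (tsupport F) :=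
      Measure.integrableOn_of_bounded (M := C) hFs.measure_lt_top.ne
        (measurable_lineIter hFc (hF i).smooth n).aestronglyMeasurable
        (Eventually.of_forall hC)
    exact h1.integrable_of_forall_notMem_eq_zero fun y hy =>
      lineIter_eq_zero_of_notMem_tsupport hy
  have key : ContDiff ℝ ∞ fun y => (F y : ℂ) := by
    refine contDiff_of_integrable_lineDerivs (Complex.continuous_ofReal.comp hFc)
      (fun i n y => (lineIter F (EuclideanSpace.single i 1) n y : ℂ))
      (hFc.integrable_of_hasCompactSupport hFs).ofReal (fun i => by simp) (fun i n y => ?_)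
      fun i n => (hint i n).ofReal
    exact (hasLineDerivAt_lineIter (hF i).smooth n y).ofReal_comp
  have hF' : ContDiff ℝ ∞ F := Complex.reCLM.contDiff.comp key
  refine hF'.contDiffAt.congr_of_eventuallyEq ?_
  filter_upwards [ρ.eventuallyEq_one] with y hy
  simp [F, hy]

end LineDerivatives

/-! ### Boman's theorem -/

section Boman

open Topology Filter

/-- A sequence of smooth functions can be damped so that its series is smooth. -/
theorem exists_pos_contDiff_tsum {E : Type*} [NormedAddCommGroup E] [NormedSpace ℝ E]
    [CompleteSpace E] (p q : ℕ → ℝ → ℝ)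
    (hp : ∀ j, ContDiff ℝ ∞ (p j)) (hq : ∀ j, ContDiff ℝ ∞ (q j))
    (hpc : ∀ j, HasCompactSupport (p j)) (hqc : ∀ j, HasCompactSupport (q j)) :
    ∃ ε : ℕ → ℝ, (∀ j, 0 < ε j) ∧ ∀ (x : ℕ → E) (v : E), (∀ j, ‖x j‖ ≤ ε j) →
      ContDiff ℝ ∞ fun t => ∑' j, (p j t • x j + q j t • (ε j • v)) := by
  have hbound : ∀ f : ℝ → ℝ, ContDiff ℝ ∞ f → HasCompactSupport f → ∀ n : ℕ,
      ∃ C, 0 ≤ C ∧ ∀ t, ‖iteratedFDeriv ℝ n f t‖ ≤ C := fun f hf hc n => by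
    obtain ⟨C, hC⟩ := (hc.iteratedFDeriv (𝕜 := ℝ) n).exists_bound_of_continuous
      (hf.continuous_iteratedFDeriv (m := n) (by exact_mod_cast le_top))
    exact ⟨C, (norm_nonneg _).trans (hC 0), hC⟩
  choose A hA0 hA using fun j => hbound (p j) (hp j) (hpc j)
  choose B hB0 hB using fun j => hbound (q j) (hq j) (hqc j)
  -- `S j` dominates all derivatives of `p j` and `q j` of order at most `j`. With `ε j = 2⁻ʲ / S
  -- j`, the `k`-th derivative of the `j`-th term is at most `2⁻ʲ (1 + ‖v‖)` once `j ≥ k`.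
  let S : ℕ → ℝ := fun j => 1 + ∑ n ∈ Finset.range (j + 1), (A j n + B j n)
  have hS : ∀ j, 0 < S j := fun j => by
    have : 0 ≤ ∑ n ∈ Finset.range (j + 1), (A j n + B j n) :=
      Finset.sum_nonneg fun n _ => add_nonneg (hA0 _ _) (hB0 _ _)
    simp only [S]; linarith
  have hSn : ∀ j n, n ≤ j → A j n + B j n ≤ S j := fun j n hn => by
    have := Finset.single_le_sum (f := fun n => A j n + B j n)
      (fun n _ => add_nonneg (hA0 j n) (hB0 j n)) (Finset.mem_range.2 (Nat.lt_succ_of_le hn))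
    simp only [S]; linarith
  have hsmul : ∀ (f : ℝ → ℝ) (hf : ContDiff ℝ ∞ f) (y : E) (n : ℕ) (t : ℝ),
      ‖iteratedFDeriv ℝ n (fun t => f t • y) t‖ ≤ ‖y‖ * ‖iteratedFDeriv ℝ n f t‖ :=
    fun f hf y n t => by
      have := (ContinuousLinearMap.toSpanSingleton ℝ y).norm_iteratedFDeriv_comp_left
        (hf.contDiffAt (x := t)) (n := n) (by exact_mod_cast le_top)
      simpa [Function.comp_def] using this
  have hε : ∀ j, 0 < (1 / 2 : ℝ) ^ j / S j := fun j => div_pos (by positivity) (hS j)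
  refine ⟨fun j => (1 / 2) ^ j / S j, hε, fun x v hx => ?_⟩
  have h1 : ∀ j, ContDiff ℝ ∞ fun t => p j t • x j := fun j => (hp j).smul contDiff_const
  have h2 : ∀ j, ContDiff ℝ ∞ fun t => q j t • (((1 / 2 : ℝ) ^ j / S j) • v) :=
    fun j => (hq j).smul contDiff_const
  refine contDiff_tsum_of_eventually (N := ⊤) (v := fun _ j => (1 / 2) ^ j * (1 + ‖v‖))
    (fun j => (h1 j).add (h2 j)) (fun _ _ => summable_geometric_two.mul_right _) fun k _ => ?_
  have hfin : {j : ℕ | j < k}.Finite := Set.finite_lt_nat k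
  filter_upwards [hfin.compl_mem_cofinite] with j hj t
  have hkj : k ≤ j := not_lt.1 hj
  have hadd := iteratedFDeriv_add_apply (i := k) (x := t)
    (((h1 j).of_le (by exact_mod_cast le_top)).contDiffAt)
    (((h2 j).of_le (by exact_mod_cast le_top)).contDiffAt)
  change ‖iteratedFDeriv ℝ k ((fun t => p j t • x j) +
    fun t => q j t • (((1 / 2 : ℝ) ^ j / S j) • v)) t‖ ≤ _
  rw [hadd]
  refine (norm_add_le _ _).trans ?_
  have e1 := (hsmul _ (hp j) (x j) k t).trans
    (mul_le_mul (hx j) (hA j k t) (norm_nonneg _) (hε j).le)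
  have e2 := hsmul _ (hq j) (((1 / 2 : ℝ) ^ j / S j) • v) k t
  rw [norm_smul, Real.norm_of_nonneg (hε j).le] at e2
  have e3 := e2.trans (mul_le_mul_of_nonneg_left (hB j k t)
    (mul_nonneg (hε j).le (norm_nonneg v)))
  have hAS : A j k ≤ S j := by linarith [hSn j k hkj, hB0 j k]
  have hBS : B j k ≤ S j := by linarith [hSn j k hkj, hA0 j k]
  have e4 : (1 / 2 : ℝ) ^ j / S j * S j = (1 / 2) ^ j := div_mul_cancel₀ _ (hS j).ne'
  calc _ ≤ (1 / 2 : ℝ) ^ j / S j * A j k + (1 / 2 : ℝ) ^ j / S j * ‖v‖ * B j k := add_le_add e1 e3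
    _ ≤ (1 / 2 : ℝ) ^ j / S j * S j + (1 / 2 : ℝ) ^ j / S j * ‖v‖ * S j := by
      have := (hε j).le
      gcongr
    _ = _ := by linear_combination (1 + ‖v‖) * e4

/-- Any sufficiently fast converging sequence of short line segments lies on a smooth curve. -/
theorem exists_smooth_curve_through_segments {E : Type*} [NormedAddCommGroup E] [NormedSpace ℝ E]
    [CompleteSpace E] : ∃ τ ε : ℕ → ℝ, Tendsto τ atTop (𝓝 0) ∧ (∀ j, 0 < ε j) ∧
      ∀ (x : ℕ → E) (v : E), (∀ j, ‖x j‖ ≤ ε j) → ∃ c : ℝ → E, ContDiff ℝ ∞ c ∧ c 0 = 0 ∧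
        ∀ j, ∀ᶠ t in 𝓝 (τ j), c t = x j + (ε j * (t - τ j)) • v := by
  let τ : ℕ → ℝ := fun j => (1 / 2) ^ j
  have hτ : ∀ j, 0 < τ j := fun j => by positivity
  -- Around `2⁻ʲ` these radii keep the supports disjoint and away from `0`.
  let θ : ∀ j, ContDiffBump (τ j) := fun j =>
    ⟨τ j / 16, τ j / 8, by linarith [hτ j], by linarith [hτ j]⟩
  have hfar : ∀ i t, τ i / 8 ≤ |t - τ i| → θ i t = 0 := fun i t h =>
    (θ i).zero_of_le_dist (by rwa [Real.dist_eq])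
  have hsep : ∀ i j t, i ≠ j → |t - τ j| < τ j / 16 → θ i t = 0 := by
    intro i j t hij ht
    apply hfar
    rw [abs_lt] at ht
    rcases lt_or_gt_of_ne hij with h | h
    · have h1 : τ j ≤ τ i / 2 := by
        have : τ j ≤ τ (i + 1) := pow_le_pow_of_le_one (by norm_num) (by norm_num) h
        have h2 : τ (i + 1) = τ i / 2 := by simp only [τ, pow_succ]; ring
        linarith
      rw [abs_of_nonpos (by linarith [hτ i])]
      linarith [hτ i]
    · have h1 : τ i ≤ τ j / 2 := by
        have : τ i ≤ τ (j + 1) := pow_le_pow_of_le_one (by norm_num) (by norm_num) h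
        have h2 : τ (j + 1) = τ j / 2 := by simp only [τ, pow_succ]; ring
        linarith
      exact le_trans (by linarith [hτ j]) (le_abs_self _)
  obtain ⟨ε, hε, hsm⟩ := exists_pos_contDiff_tsum (E := E) (fun j => θ j)
    (fun j t => θ j t * (t - τ j)) (fun j => (θ j).contDiff)
    (fun j => (θ j).contDiff.mul (by fun_prop)) (fun j => (θ j).hasCompactSupport)
    (fun j => (θ j).hasCompactSupport.mul_right)
  refine ⟨τ, ε, tendsto_pow_atTop_nhds_zero_of_lt_one (by norm_num) (by norm_num), hε,
    fun x v hx => ⟨_, hsm x v hx, ?_, fun j => ?_⟩⟩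
  · have : ∀ j, θ j 0 = 0 := fun j => hfar j 0 (by
      rw [zero_sub, abs_neg, abs_of_pos (hτ j)]; linarith [hτ j])
    simp [this]
  · have h1 : ∀ᶠ t in 𝓝 (τ j), |t - τ j| < τ j / 16 := by
      have : Metric.ball (τ j) (τ j / 16) ∈ 𝓝 (τ j) :=
        Metric.ball_mem_nhds _ (by linarith [hτ j])
      filter_upwards [this] with t ht
      rwa [Metric.mem_ball, Real.dist_eq] at ht
    filter_upwards [h1] with t ht
    rw [tsum_eq_single j fun i hi => by simp [hsep i j t hi ht]]
    have : θ j t = 1 := (θ j).one_of_mem_closedBall (by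
      rw [Metric.mem_closedBall, Real.dist_eq]; exact ht.le)
    rw [this, one_smul, one_mul, smul_smul, mul_comm]

variable {E : Type*} [NormedAddCommGroup E] [NormedSpace ℝ E] [CompleteSpace E]

/-- Since `ε` is fixed before the points, a discontinuity at `x` supplies points `y j` within `ε j`
of `x` at which `f` stays `η` away from `f x`. A smooth curve through them at times `τ j → 0` is a
contradiction. -/
theorem continuous_of_smooth_along_curves {f : E → ℝ}
    (hf : ∀ c : ℝ → E, ContDiff ℝ ∞ c → ContDiff ℝ ∞ (f ∘ c)) : Continuous f := by
  obtain ⟨τ, ε, hτ, hε, hcurve⟩ := exists_smooth_curve_through_segments (E := E)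
  rw [continuous_iff_continuousAt]
  intro x
  rw [Metric.continuousAt_iff]
  by_contra! hcon
  obtain ⟨η, hη, hcon⟩ := hcon
  choose y hy hfy using fun j => hcon (ε j) (hε j)
  obtain ⟨c, hc, hc0, hcj⟩ := hcurve (fun j => y j - x) 0 fun j => by
    rw [← dist_eq_norm]; exact (hy j).le
  have hcτ : ∀ j, c (τ j) = y j - x := fun j => by simpa using (hcj j).self_of_nhds
  have h1 := (hf (fun t => x + c t) (contDiff_const.add hc)).continuous.tendsto 0
  have h2 := h1.comp hτ
  simp only [Function.comp_def, hc0, hcτ, add_zero, add_sub_cancel] at h2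
  obtain ⟨j, hj⟩ := ((Metric.tendsto_nhds.1 h2) η hη).exists
  exact absurd (hfy j) (not_le.2 hj)

/-- If the bound failed near `x`, there would be points `y j` with `n`-th derivative larger than `j
/ ε j ^ n`. A smooth curve passes each `y j` along a segment with velocity `ε j • v`, so `f` along
it has `n`-th derivative larger than `j` at `τ j → 0`. -/
theorem LocBddLineDerivs.of_smooth_along_curves {f : E → ℝ}
    (hf : ∀ c : ℝ → E, ContDiff ℝ ∞ c → ContDiff ℝ ∞ (f ∘ c)) (v : E) :
    LocBddLineDerivs f v where
  smooth x := hf (fun t => x + t • v) (by fun_prop)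
  bdd n x := by
    obtain ⟨τ, ε, hτ, hε, hcurve⟩ := exists_smooth_curve_through_segments (E := E)
    by_contra! hcon
    have h1 : ∀ j : ℕ, ∃ y, ‖y - x‖ ≤ ε j ∧ (j : ℝ) / ε j ^ n < |lineIter f v n y| := fun j => by
      obtain ⟨y, hy, hy'⟩ := ((hcon (j / ε j ^ n)).and_eventually
        (Metric.ball_mem_nhds x (hε j))).exists
      exact ⟨y, by rw [← dist_eq_norm]; exact (Metric.mem_ball.1 hy').le, hy⟩
    choose y hy hfy using h1
    obtain ⟨c, hc, hc0, hcj⟩ := hcurve (fun j => y j - x) v hy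
    have hsm := hf (fun t => x + c t) (contDiff_const.add hc)
    have hder : ∀ j, iteratedDeriv n (f ∘ fun t => x + c t) (τ j) =
        ε j ^ n * lineIter f v n (y j) := fun j => by
      have e1 : (f ∘ fun t => x + c t) =ᶠ[𝓝 (τ j)]
          fun t => (fun s => f (y j + (ε j * s) • v)) (t - τ j) := by
        filter_upwards [hcj j] with t ht
        simp only [Function.comp_apply, ht]
        congr 1
        abel
      rw [e1.iteratedDeriv_eq,
        iteratedDeriv_comp_sub_const n (fun s => f (y j + (ε j * s) • v)) (τ j),
        iteratedDeriv_comp_const_mul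
          (f := fun s : ℝ => f (y j + s • v)) ((hf (fun t => y j + t • v) (by fun_prop)).of_le
            (by exact_mod_cast le_top))]
      simp [lineIter]
    have h2 : Tendsto (fun j => iteratedDeriv n (f ∘ fun t => x + c t) (τ j)) atTop
        (𝓝 (iteratedDeriv n (f ∘ fun t => x + c t) 0)) :=
      ((hsm.continuous_iteratedDeriv n (by exact_mod_cast le_top)).tendsto 0).comp hτ
    have h3 : Tendsto (fun j => |iteratedDeriv n (f ∘ fun t => x + c t) (τ j)|) atTop atTop := by
      refine tendsto_atTop_mono (fun j => ?_) tendsto_natCast_atTop_atTop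
      rw [hder, abs_mul, abs_of_pos (pow_pos (hε j) n)]
      have := (div_lt_iff₀ (pow_pos (hε j) n)).1 (hfy j)
      linarith
    exact not_tendsto_atTop_of_tendsto_nhds h2.abs h3

/-- **Boman's theorem**: a function on a finite-dimensional space which is smooth along all smooth
curves is smooth. -/
theorem contDiff_of_smooth_along_curves {V : Type*} [NormedAddCommGroup V] [NormedSpace ℝ V]
    [FiniteDimensional ℝ V] {f : V → ℝ}
    (hf : ∀ c : ℝ → V, ContDiff ℝ ∞ c → ContDiff ℝ ∞ (f ∘ c)) : ContDiff ℝ ∞ f := by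
  let e : V ≃L[ℝ] EuclideanSpace ℝ (Fin (Module.finrank ℝ V)) :=
    ContinuousLinearEquiv.ofFinrankEq (by simp)
  have h1 : ∀ c : ℝ → EuclideanSpace ℝ (Fin (Module.finrank ℝ V)), ContDiff ℝ ∞ c →
      ContDiff ℝ ∞ ((f ∘ e.symm) ∘ c) := fun c hc => hf (e.symm ∘ c) (e.symm.contDiff.comp hc)
  have h2 : ContDiff ℝ ∞ (f ∘ e.symm) := contDiff_of_locBddLineDerivs
    (continuous_of_smooth_along_curves h1) fun i => .of_smooth_along_curves h1 _
  have h3 := h2.comp e.contDiff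
  simpa [Function.comp_def] using h3

end Boman

/-! ### Joint smoothness by uniform boundedness -/

section SeparateSmoothness

open Topology Filter
open scoped lp

/-- A curve of functionals on a Banach space which is pointwise smooth has pointwise derivatives
that are again functionals. -/
theorem exists_iteratedDeriv_functional {F : Type*} [NormedAddCommGroup F] [NormedSpace ℝ F]
    [CompleteSpace F] (T : ℝ → F →L[ℝ] ℝ) (hT : ∀ a, ContDiff ℝ ∞ fun t => T t a) (n : ℕ) :
    ∃ S : ℝ → F →L[ℝ] ℝ, ∀ t a, S t a = iteratedDeriv n (fun t => T t a) t := by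
  induction n with
  | zero => exact ⟨T, fun t a => by simp⟩
  | succ n ih =>
    obtain ⟨S, hS⟩ := ih
    -- On a Banach space a pointwise limit of continuous functionals is again continuous.
    have hlim : ∀ t, Tendsto (fun (h : ℝ) (a : F) => (h⁻¹ • (S (t + h) - S t)) a) (𝓝[≠] 0)
        (𝓝 fun a => iteratedDeriv (n + 1) (fun t => T t a) t) := fun t => by
      refine tendsto_pi_nhds.2 fun a => ?_
      have hd : HasDerivAt (iteratedDeriv n fun t => T t a)
          (iteratedDeriv (n + 1) (fun t => T t a) t) t := by
        rw [iteratedDeriv_succ]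
        exact ((hT a).differentiable_iteratedDeriv n
          (by exact_mod_cast ENat.natCast_lt_top n) t).hasDerivAt
      simpa [hS] using hasDerivAt_iff_tendsto_slope_zero.1 hd
    exact ⟨fun t => continuousLinearMapOfTendsto _ (hlim t), fun t a => rfl⟩

/-- Each `a` gives a continuous derivative, bounded on the compact interval; Banach–Steinhaus makes
the bound uniform in `a`. -/
theorem exists_bound_iteratedDeriv_functional {F : Type*} [NormedAddCommGroup F] [NormedSpace ℝ F]
    [CompleteSpace F] (T : ℝ → F →L[ℝ] ℝ) (hT : ∀ a, ContDiff ℝ ∞ fun t => T t a) (n : ℕ) (R : ℝ) :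
    ∃ C, ∀ t ∈ Set.Icc (-R) R, ∀ a, |iteratedDeriv n (fun t => T t a) t| ≤ C * ‖a‖ := by
  obtain ⟨S, hS⟩ := exists_iteratedDeriv_functional T hT n
  obtain ⟨C, hC⟩ := banach_steinhaus (g := fun t : Set.Icc (-R) R => S t) fun a => by
    obtain ⟨C, hC⟩ := (isCompact_Icc (a := -R) (b := R)).exists_bound_of_continuousOn
      ((hT a).continuous_iteratedDeriv n (by exact_mod_cast le_top)).continuousOn
    exact ⟨C, fun t => by simpa only [hS] using hC t t.2⟩
  refine ⟨C, fun t ht a => ?_⟩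
  rw [← hS]
  exact (S t).le_of_opNorm_le (hC ⟨t, ht⟩) a

/-- The functional on `ℓ¹` given by a bounded function. -/
theorem exists_functional_of_bounded {ι : Type*} (b : ι → ℝ) (hb : ∃ C, ∀ i, |b i| ≤ C) :
    ∃ T : ℓ^1(ι, ℝ) →L[ℝ] ℝ, ∀ a, T a = ∑' i, a i * b i := by
  obtain ⟨C, hC⟩ := hb
  have hs : ∀ a : ℓ^1(ι, ℝ), Summable fun i => |a i| := fun a => by
    simpa using (lp.memℓp a).summable (by simp)
  have hab : ∀ (a : ℓ^1(ι, ℝ)) i, |a i * b i| ≤ C * |a i| := fun a i => by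
    rw [abs_mul, mul_comm]
    exact mul_le_mul_of_nonneg_right (hC i) (abs_nonneg _)
  have hsum : ∀ a : ℓ^1(ι, ℝ), Summable fun i => a i * b i := fun a =>
    .of_norm_bounded ((hs a).mul_left C) (hab a)
  refine ⟨LinearMap.mkContinuous
    { toFun := fun a => ∑' i, a i * b i
      map_add' := fun x y => by
        rw [← (hsum x).tsum_add (hsum y)]; simp [add_mul]
      map_smul' := fun r x => by
        rw [RingHom.id_apply, smul_eq_mul, ← tsum_mul_left]; simp [mul_assoc] } C fun a => ?_,
    fun a => rfl⟩
  have hn : ‖a‖ = ∑' i, |a i| := by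
    simpa using lp.norm_eq_tsum_rpow (p := 1) (by simp) a
  rw [hn, ← tsum_mul_left]
  exact tsum_of_norm_bounded ((hs a).mul_left C).hasSum (hab a)

/-- A function of two variables is smooth once it is smooth in the second one and its derivatives
there are weakly smooth in the first one, tested against absolutely convergent sums of
evaluations. -/
theorem contDiff_of_smooth_sums {g : ℝ × ℝ → ℝ} (h1 : ∀ t, ContDiff ℝ ∞ fun s => g (t, s))
    (h2 : ∀ (m : ℕ) (R : ℝ) (a : Set.Icc (-R) R → ℝ), (Summable fun s => |a s|) →
      ContDiff ℝ ∞ fun t => ∑' s, a s * iteratedDeriv m (fun s => g (t, s)) s) :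
    ContDiff ℝ ∞ g := by
  classical
  have hpt : ∀ m s, ContDiff ℝ ∞ fun t => iteratedDeriv m (fun s => g (t, s)) s := fun m s => by
    have hs : s ∈ Set.Icc (-|s|) |s| := abs_le.1 le_rfl
    have := h2 m |s| (Pi.single ⟨s, hs⟩ 1)
      (summable_of_ne_finset_zero (s := {⟨s, hs⟩}) fun b hb => by
        rw [Finset.mem_singleton] at hb
        simp [Pi.single_eq_of_ne hb])
    have h3 : ∀ t, (∑' s', (Pi.single ⟨s, hs⟩ 1 : Set.Icc (-|s|) |s| → ℝ) s' *
        iteratedDeriv m (fun s => g (t, s)) s') = iteratedDeriv m (fun s => g (t, s)) s := fun t => by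
      rw [tsum_eq_single ⟨s, hs⟩ fun b hb => by simp [Pi.single_eq_of_ne hb]]
      simp
    simpa only [h3] using this
  -- The `m`-th `s`-derivatives on `[-R, R]` form a functional `T t` on `ℓ¹`. Its `t`-derivatives
  -- are bounded in operator norm, and evaluation on unit vectors makes the bound uniform in `s`.
  have hbd : ∀ m n R, ∃ C, ∀ t ∈ Set.Icc (-R) R, ∀ s ∈ Set.Icc (-R) R,
      |iteratedDeriv n (fun t => iteratedDeriv m (fun s => g (t, s)) s) t| ≤ C := fun m n R => by
    have hb : ∀ t, ∃ C, ∀ s : Set.Icc (-R) R, |iteratedDeriv m (fun s => g (t, s)) s| ≤ C :=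
      fun t => by
        obtain ⟨C, hC⟩ := (isCompact_Icc (a := -R) (b := R)).exists_bound_of_continuousOn
          ((h1 t).continuous_iteratedDeriv m (by exact_mod_cast le_top)).continuousOn
        exact ⟨C, fun s => hC s s.2⟩
    choose T hT using fun t => exists_functional_of_bounded _ (hb t)
    have hTs : ∀ a, ContDiff ℝ ∞ fun t => T t a := fun a => by
      simp only [hT]
      exact h2 m R a (by simpa using (lp.memℓp a).summable (by simp))
    obtain ⟨C, hC⟩ := exists_bound_iteratedDeriv_functional T hTs n R
    refine ⟨C, fun t ht s hs => ?_⟩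
    have h3 : ∀ t, T t (lp.single 1 (⟨s, hs⟩ : Set.Icc (-R) R) (1 : ℝ)) =
        iteratedDeriv m (fun s => g (t, s)) s := fun t => by
      rw [hT, tsum_eq_single ⟨s, hs⟩ fun b hb => by
        simp [lp.single_apply, Pi.single_eq_of_ne hb]]
      simp [lp.single_apply]
    simpa [h3, lp.norm_single] using hC t ht (lp.single 1 (⟨s, hs⟩ : Set.Icc (-R) R) (1 : ℝ))
  have hcont : Continuous g := by
    rw [continuous_iff_continuousAt]
    rintro ⟨t₀, s₀⟩
    let R := |t₀| + |s₀| + 1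
    obtain ⟨C, hC⟩ := hbd 0 1 R
    simp only [iteratedDeriv_zero, iteratedDeriv_one] at hC
    have hmem : ∀ᶠ p : ℝ × ℝ in 𝓝 (t₀, s₀), p.1 ∈ Set.Icc (-R) R ∧ p.2 ∈ Set.Icc (-R) R := by
      have ht : Set.Icc (-R) R ∈ 𝓝 t₀ := Icc_mem_nhds
        (by linarith [neg_abs_le t₀, abs_nonneg s₀]) (by linarith [le_abs_self t₀, abs_nonneg s₀])
      have hs : Set.Icc (-R) R ∈ 𝓝 s₀ := Icc_mem_nhds
        (by linarith [neg_abs_le s₀, abs_nonneg t₀]) (by linarith [le_abs_self s₀, abs_nonneg t₀])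
      exact prod_mem_nhds ht hs
    have ht₀ : t₀ ∈ Set.Icc (-R) R := (hmem.self_of_nhds).1
    have hlim : Tendsto (fun p : ℝ × ℝ => C * |p.1 - t₀| + |g (t₀, p.2) - g (t₀, s₀)|)
        (𝓝 (t₀, s₀)) (𝓝 0) := by
      have hc : Continuous fun p : ℝ × ℝ => C * |p.1 - t₀| + |g (t₀, p.2) - g (t₀, s₀)| := by
        have h3 : Continuous fun p : ℝ × ℝ => g (t₀, p.2) :=
          (h1 t₀).continuous.comp continuous_snd
        have h4 : Continuous fun p : ℝ × ℝ => |p.1 - t₀| := by fun_prop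
        exact (h4.const_mul C).add (h3.sub continuous_const).abs
      simpa using hc.tendsto (t₀, s₀)
    rw [ContinuousAt, tendsto_iff_dist_tendsto_zero]
    -- The mean value inequality in `t`, uniform in `s`, combines with continuity in `s` at the
    -- single time `t₀`.
    refine squeeze_zero' (Eventually.of_forall fun _ => dist_nonneg) ?_ hlim
    filter_upwards [hmem] with p hp
    have e1 : |g (p.1, p.2) - g (t₀, p.2)| ≤ C * |p.1 - t₀| := by
      have hsm := hpt 0 p.2
      simp only [iteratedDeriv_zero] at hsm
      exact (convex_Icc (-R) R).norm_image_sub_le_of_norm_deriv_le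
        (fun t _ => (hsm.differentiable (by simp)) t) (fun t ht => hC t ht p.2 hp.2) ht₀ hp.1
    rw [Real.dist_eq]
    calc |g p - g (t₀, s₀)| = |(g (p.1, p.2) - g (t₀, p.2)) + (g (t₀, p.2) - g (t₀, s₀))| := by
          congr 1; ring
      _ ≤ _ := (abs_add_le _ _).trans (by linarith)
  let f : EuclideanSpace ℝ (Fin 2) → ℝ := fun p => g (p 0, p 1)
  have hf : ContDiff ℝ ∞ f := by
    refine contDiff_of_locBddLineDerivs (hcont.comp (by fun_prop)) fun i => ?_
    have hball : ∀ x : EuclideanSpace ℝ (Fin 2), ∀ᶠ y in 𝓝 x, ∀ i,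
        y i ∈ Set.Icc (-(‖x‖ + 1)) (‖x‖ + 1) := fun x => by
      filter_upwards [continuous_norm.continuousAt.eventually (gt_mem_nhds (lt_add_one ‖x‖))]
        with y hy i
      exact abs_le.1 ((PiLp.norm_apply_le y i).trans hy.le)
    fin_cases i
    · have hl : ∀ (x : EuclideanSpace ℝ (Fin 2)) (t : ℝ),
          f (x + t • EuclideanSpace.single 0 1) = g (x 0 + t, x 1) := fun x t => by simp [f]
      refine ⟨fun x => ?_, fun n x => ?_⟩
      · simp only [Fin.zero_eta, hl]
        exact (hpt 0 (x 1)).comp (by fun_prop : ContDiff ℝ ∞ fun t : ℝ => x 0 + t)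
      · obtain ⟨C, hC⟩ := hbd 0 n (‖x‖ + 1)
        refine ⟨C, (hball x).mono fun y hy => ?_⟩
        have := hC (y 0) (hy 0) (y 1) (hy 1)
        simp only [Fin.zero_eta, lineIter, hl]
        rw [iteratedDeriv_comp_const_add n (fun t => g (t, y 1)) (y 0)]
        simpa using this
    · have hl : ∀ (x : EuclideanSpace ℝ (Fin 2)) (t : ℝ),
          f (x + t • EuclideanSpace.single 1 1) = g (x 0, x 1 + t) := fun x t => by simp [f]
      refine ⟨fun x => ?_, fun n x => ?_⟩
      · simp only [Fin.mk_one, hl]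
        exact (h1 (x 0)).comp (by fun_prop : ContDiff ℝ ∞ fun t : ℝ => x 1 + t)
      · obtain ⟨C, hC⟩ := hbd n 0 (‖x‖ + 1)
        refine ⟨C, (hball x).mono fun y hy => ?_⟩
        have := hC (y 0) (hy 0) (y 1) (hy 1)
        simp only [Fin.mk_one, lineIter, hl]
        rw [iteratedDeriv_comp_const_add n (fun s => g (y 0, s)) (y 1)]
        simpa using this
  have hL : ContDiff ℝ ∞ fun p : ℝ × ℝ => (!₂[p.1, p.2] : EuclideanSpace ℝ (Fin 2)) := by
    rw [contDiff_euclidean]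
    intro i
    fin_cases i <;> simp <;> fun_prop
  have := hf.comp hL
  simpa [f, Function.comp_def] using this

end SeparateSmoothness

/-! ### Weighted sums of a smooth kernel -/

section WeightedSums

open Topology Filter

theorem iteratedDeriv_snd_eq_lineIter (G : ℝ × ℝ → ℝ) (m : ℕ) (t s : ℝ) :
    iteratedDeriv m (fun s => G (t, s)) s = lineIter G (0, 1) m (t, s) := by
  have := lineIter_add_smul G (0, 1) m (t, 0) s
  simpa using this.symm

theorem iteratedDeriv_fst_eq_lineIter (G : ℝ × ℝ → ℝ) (m : ℕ) (t s : ℝ) :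
    iteratedDeriv m (fun t => G (t, s)) t = lineIter G (1, 0) m (t, s) := by
  have := lineIter_add_smul G (1, 0) m (0, s) t
  simpa using this.symm

/-- After a cut-off in `t`, all `t`-derivatives of the kernel are bounded uniformly in `s ∈ [-R,
R]`, so the series may be differentiated termwise. -/
theorem contDiff_weighted_tsum {K : ℝ × ℝ → ℝ} (hK : ContDiff ℝ ∞ K) {R : ℝ}
    {a : Set.Icc (-R) R → ℝ} (ha : Summable fun s => |a s|) :
    ContDiff ℝ ∞ fun t => ∑' s, a s * K (t, s) := by
  rw [contDiff_iff_contDiffAt]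
  intro t₀
  let ρ : ContDiffBump t₀ := ⟨1, 2, by norm_num, by norm_num⟩
  let L : ℝ × ℝ → ℝ := fun p => ρ p.1 * K p
  have hL : ContDiff ℝ ∞ L := (ρ.contDiff.comp contDiff_fst).mul hK
  have hLs : ∀ s : ℝ, ContDiff ℝ ∞ fun t => L (t, s) := fun s => hL.comp (by fun_prop)
  have hbound : ∀ n : ℕ, ∃ C, ∀ t, ∀ s ∈ Set.Icc (-R) R,
      ‖iteratedFDeriv ℝ n (fun t => L (t, s)) t‖ ≤ C := fun n => by
    obtain ⟨C, hC⟩ := ((isCompact_closedBall t₀ 2).prod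
      (isCompact_Icc (a := -R) (b := R))).exists_bound_of_continuousOn
      (contDiff_lineIter hL (1, 0) n).continuous.continuousOn
    refine ⟨max C 0, fun t s hs => ?_⟩
    rw [norm_iteratedFDeriv_eq_norm_iteratedDeriv]
    by_cases ht : t ∈ Metric.closedBall t₀ 2
    · rw [iteratedDeriv_fst_eq_lineIter]
      exact (hC (t, s) ⟨ht, hs⟩).trans (le_max_left _ _)
    · have h0 : (fun t => L (t, s)) =ᶠ[𝓝 t] fun _ => 0 := by
        filter_upwards [Metric.isClosed_closedBall.isOpen_compl.mem_nhds ht] with t' ht'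
        have : ρ t' = 0 := ρ.zero_of_le_dist (by
          simp only [Set.mem_compl_iff, Metric.mem_closedBall, not_le] at ht'; exact ht'.le)
        simp [L, this]
      rw [h0.iteratedDeriv_eq]
      simp
  choose C hC using hbound
  have key : ContDiff ℝ ∞ fun t => ∑' s : Set.Icc (-R) R, a s * L (t, s) := by
    refine contDiff_tsum (N := ⊤) (v := fun n s => |a s| * C n)
      (fun s => contDiff_const.mul (hLs s)) (fun n _ => ha.mul_right _) fun n s t _ => ?_
    have h1 := (ContinuousLinearMap.mul ℝ ℝ (a s)).norm_iteratedFDeriv_comp_left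
      ((hLs s).contDiffAt (x := t)) (n := n) (by exact_mod_cast le_top)
    refine h1.trans (mul_le_mul ?_ (hC n t s s.2) (norm_nonneg _) (abs_nonneg _))
    simp
  refine key.contDiffAt.congr_of_eventuallyEq ?_
  filter_upwards [ρ.eventuallyEq_one] with t ht
  simp [L, ht]

end WeightedSums

/-! ### Euclidean Frölicher spaces -/

section EuclideanSpaces

/-- A normed space with a Frölicher structure whose curves are the smooth ones. -/
class IsEuclideanFrolicher (E : Type*) [NormedAddCommGroup E] [NormedSpace ℝ E]
    [FrolicherSpace E] : Prop where
  mem_curves_iff_contDiff : ∀ c : ℝ → E, c ∈ curves ↔ ContDiff ℝ ∞ c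


instance : IsEuclideanFrolicher ℝ := ⟨fun _ => Iff.rfl⟩

instance (n : ℕ) : IsEuclideanFrolicher (Fin n → ℝ) where
  mem_curves_iff_contDiff _ := ⟨fun hc => contDiff_pi.2 fun i =>
    hc (fun x => x i) fun d hd =>
      contDiff_pi.1 (show ContDiff ℝ ∞ d from hd) i, fun hc _ hf => hf _ hc⟩

variable {E F : Type*} [NormedAddCommGroup E] [NormedSpace ℝ E] [FrolicherSpace E]
  [IsEuclideanFrolicher E] [NormedAddCommGroup F] [NormedSpace ℝ F] [FrolicherSpace F]
  [IsEuclideanFrolicher F]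

instance : IsEuclideanFrolicher (E × F) where
  mem_curves_iff_contDiff c := by
    refine Iff.trans (and_congr (IsEuclideanFrolicher.mem_curves_iff_contDiff _) (IsEuclideanFrolicher.mem_curves_iff_contDiff _)) ?_
    exact ⟨fun h => h.1.prodMk h.2, fun h => ⟨h.fst, h.snd⟩⟩

/-- Functions are only required to be smooth along curves; Boman's theorem makes them accessible to
Taylor expansion. -/
theorem mem_functions_iff_contDiff [FiniteDimensional ℝ E] (f : E → ℝ) :
    f ∈ functions ↔ ContDiff ℝ ∞ f := by
  rw [mem_functions_iff]
  refine ⟨fun h => contDiff_of_smooth_along_curves fun c hc =>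
    h c ((IsEuclideanFrolicher.mem_curves_iff_contDiff c).2 hc), fun h c hc =>
    h.comp ((IsEuclideanFrolicher.mem_curves_iff_contDiff c).1 hc)⟩

end EuclideanSpaces

/-! ### Curves in exponentials -/

section Exponentials

/-- A function on a Frölicher space as a smooth map to the real line. -/
def SmoothMap.ofFunction {X : Type*} [FrolicherSpace X] (χ : CInfty X) : SmoothMap X ℝ :=
  ⟨χ.1, fun c hc => (mem_functions_iff _).1 χ.2 c hc⟩

/-- A curve in a Frölicher space as a smooth map from the real line. -/
def SmoothMap.ofCurve {X : Type*} [FrolicherSpace X] (d : ℝ → X) (hd : d ∈ curves) :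
    SmoothMap ℝ X :=
  ⟨d, fun _ hc => (mem_curves_iff _).2 fun f hf => ((mem_curves_iff d).1 hd f hf).comp hc⟩

/-- Precomposition with a smooth map `Z → X`, as a smooth map from `Y ^ X` to `Y ^ Z`. -/
def SmoothMap.precomp {X Z : Type*} (Y : Type*) [FrolicherSpace X] [FrolicherSpace Y]
    [FrolicherSpace Z] (d : SmoothMap Z X) : SmoothMap (SmoothMap X Y) (SmoothMap Z Y) :=
  ofFunctions (fun f => f.comp d) fun _ hχ c hc =>
    hχ (fun t => (c t).comp d) fun s hs e he => hc s hs _ (d.smooth e he)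

theorem SmoothMap.contDiff_real (h : SmoothMap ℝ ℝ) : ContDiff ℝ ∞ h :=
  h.smooth (fun t => t) (show ContDiff ℝ ∞ fun t : ℝ => t from contDiff_id)

/-- Absolutely convergent sums of point evaluations of a derivative are functions on `C^∞(ℝ)`. -/
theorem weightedSum_mem_functions (m : ℕ) (R : ℝ) (a : Set.Icc (-R) R → ℝ)
    (ha : Summable fun s => |a s|) :
    (fun h : SmoothMap ℝ ℝ => ∑' s, a s * iteratedDeriv m h s) ∈ functions := by
  intro c hc
  -- Only the generating curves have to be tested, and their adjoints are smooth by Boman's theorem.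
  have hG : ContDiff ℝ ∞ fun p : ℝ × ℝ => c p.1 p.2 :=
    contDiff_of_smooth_along_curves fun d hd => hc _ hd.fst _ hd.snd
  have := contDiff_weighted_tsum (contDiff_lineIter hG (0, 1) m) ha
  simp only [← iteratedDeriv_snd_eq_lineIter] at this
  exact this

theorem contDiff_uncurry_of_mem_curves {c : ℝ → SmoothMap ℝ ℝ} (hc : c ∈ curves) :
    ContDiff ℝ ∞ fun p : ℝ × ℝ => c p.1 p.2 :=
  contDiff_of_smooth_sums (fun t => (c t).contDiff_real) fun m R a ha =>
    (mem_curves_iff c).1 hc _ (weightedSum_mem_functions m R a ha)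

/-- The curves of an exponential are exactly the maps whose adjoint is smooth. -/
theorem SmoothMap.mem_curves_iff_uncurry {X Y : Type*} [FrolicherSpace X] [FrolicherSpace Y]
    {c : ℝ → SmoothMap X Y} : c ∈ curves ↔ ∀ s : ℝ → ℝ, ContDiff ℝ ∞ s →
      ∀ d ∈ curves (X := X), (fun t => c (s t) (d t)) ∈ curves (X := Y) := by
  refine ⟨fun hc s hs d hd => (mem_curves_iff _).2 fun χ hχ => ?_, fun hc _ hf => hf c hc⟩
  -- A function on `Y` and a curve in `X` reduce the claim to curves in the exponential `ℝ ^ ℝ`.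
  have h1 := (postcomp ℝ (ofFunction ⟨χ, hχ⟩)).smooth _ ((precomp Y (ofCurve d hd)).smooth c hc)
  exact (contDiff_uncurry_of_mem_curves h1).comp (hs.prodMk contDiff_id)

/-- The pairing of two smooth maps. -/
def SmoothMap.pair {X Y Z : Type*} [FrolicherSpace X] [FrolicherSpace Y] [FrolicherSpace Z]
    (f : SmoothMap Z X) (g : SmoothMap Z Y) : SmoothMap Z (X × Y) :=
  ⟨fun z => (f z, g z), fun c hc => ⟨f.smooth c hc, g.smooth c hc⟩⟩

/-- Pairing is a smooth map `X ^ Z × Y ^ Z → (X × Y) ^ Z`. -/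
def SmoothMap.pairing (X Y Z : Type*) [FrolicherSpace X] [FrolicherSpace Y] [FrolicherSpace Z] :
    SmoothMap (SmoothMap Z X × SmoothMap Z Y) (SmoothMap Z (X × Y)) :=
  ⟨fun p => p.1.pair p.2, fun _ hc => mem_curves_iff_uncurry.2 fun s hs d hd =>
    ⟨mem_curves_iff_uncurry.1 hc.1 s hs d hd, mem_curves_iff_uncurry.1 hc.2 s hs d hd⟩⟩

end Exponentials

/-! ### Slices, diagonals and extended ideals -/

section Slices

variable {X Y Z : Type*} [FrolicherSpace X] [FrolicherSpace Y] [FrolicherSpace Z]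

/-- The inclusion of the slice `X × {z}`. -/
def SmoothMap.insFst (z : Z) : SmoothMap X (X × Z) :=
  ⟨fun x => (x, z), fun _ hc => ⟨hc, const_mem_curves z⟩⟩

/-- The inclusion of the slice `{x} × Z`. -/
def SmoothMap.insSnd (x : X) : SmoothMap Z (X × Z) :=
  ⟨fun z => (x, z), fun _ hc => ⟨const_mem_curves x, hc⟩⟩

/-- The product of two smooth maps. -/
def SmoothMap.prodMap {X' Y' : Type*} [FrolicherSpace X'] [FrolicherSpace Y']
    (f : SmoothMap X X') (g : SmoothMap Y Y') : SmoothMap (X × Y) (X' × Y') :=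
  (f.comp fst).pair (g.comp snd)

namespace CInfty

/-- The restriction of functions on `X × Z` to the slice `X × {z}`. -/
abbrev sliceFst (z : Z) : CInfty (X × Z) →ₐ[ℝ] CInfty X := pullback (SmoothMap.insFst z)

/-- The restriction of functions on `X × Z` to the slice `{x} × Z`. -/
abbrev sliceSnd (x : X) : CInfty (X × Z) →ₐ[ℝ] CInfty Z := pullback (SmoothMap.insSnd x)

/-- The restriction of functions on `X × X` to the diagonal. -/
abbrev restrictDiag : CInfty (X × X) →ₐ[ℝ] CInfty X :=
  pullback ((SmoothMap.id X).pair (SmoothMap.id X))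

/-- The pull-back of functions along the first projection. -/
abbrev ofFst : CInfty X →ₐ[ℝ] CInfty (X × Z) := pullback SmoothMap.fst

/-- The pull-back of functions along the second projection. -/
abbrev ofSnd : CInfty Z →ₐ[ℝ] CInfty (X × Z) := pullback SmoothMap.snd

theorem ext_apply {f g : CInfty X} (h : ∀ x, f.1 x = g.1 x) : f = g := Subtype.ext (funext h)

theorem sliceFst_ofFst (z : Z) (f : CInfty X) : sliceFst z (ofFst f) = f := rfl

theorem diag_ofFst (f : CInfty X) : restrictDiag (ofFst f) = f := rfl

theorem diag_ofSnd (f : CInfty X) : restrictDiag (ofSnd f) = f := rfl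

theorem sliceFst_ofSnd (z : Z) (f : CInfty Z) :
    sliceFst (X := X) z (ofSnd f) = algebraMap ℝ _ (f.1 z) := rfl

/-- The ideal of functions vanishing at the base point. -/
def vanishing (M : Type*) [FrolicherSpace M] [Zero M] : Ideal (CInfty M) where
  carrier := {f | f.1 0 = 0}
  add_mem' {f g} hf hg := by
    change f.1 0 + g.1 0 = 0
    rw [show f.1 0 = 0 from hf, show g.1 0 = 0 from hg, add_zero]
  zero_mem' := rfl
  smul_mem' f g hg := by
    change f.1 0 * g.1 0 = 0
    rw [show g.1 0 = 0 from hg, mul_zero]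

theorem mem_vanishing {M : Type*} [FrolicherSpace M] [Zero M] {f : CInfty M} :
    f ∈ vanishing M ↔ f.1 0 = 0 := Iff.rfl

/-- Slicing is an algebra homomorphism that is left inverse to pull-back along the projection, so it
carries the extended ideal back into `J`. -/
theorem sliceFst_mem_of_mem_map {J : Ideal (CInfty X)} {H : CInfty (X × Z)}
    (hH : H ∈ J.map (ofFst (Z := Z))) (z : Z) : sliceFst z H ∈ J := by
  have h1 := Ideal.mem_map_of_mem (sliceFst (X := X) z) hH
  rw [Ideal.map_mapₐ] at h1
  have h2 : ((sliceFst (X := X) z).comp (ofFst (Z := Z))) = AlgHom.id ℝ _ := rfl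
  rw [h2] at h1
  simpa using (Ideal.map_id J) ▸ h1

theorem diag_mem_of_mem_map {J : Ideal (CInfty X)} {H : CInfty (X × X)}
    (hH : H ∈ J.map (ofFst (Z := X))) : restrictDiag H ∈ J := by
  have h1 := Ideal.mem_map_of_mem (restrictDiag (X := X)) hH
  rw [Ideal.map_mapₐ] at h1
  have h2 : ((restrictDiag (X := X)).comp (ofFst (Z := X))) = AlgHom.id ℝ _ := rfl
  rw [h2] at h1
  simpa using (Ideal.map_id J) ▸ h1

theorem mk_sliceFst_eq {I : Ideal (CInfty X)} {n : ℕ} {b : Fin n → CInfty X} {c : Fin n → CInfty Z} {H : CInfty (X × Z)}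
    (h : H - ∑ i, ofFst (b i) * ofSnd (c i) ∈ I.map (ofFst (Z := Z))) (z : Z) :
    Ideal.Quotient.mk I (sliceFst z H) = ∑ i, (c i).1 z • Ideal.Quotient.mk I (b i) := by
  have h1 := Ideal.Quotient.eq.2 (by rw [← map_sub]; exact sliceFst_mem_of_mem_map h z :
    sliceFst z H - sliceFst z (∑ i, ofFst (b i) * ofSnd (c i)) ∈ I)
  rw [h1, map_sum, map_sum]
  refine Finset.sum_congr rfl fun i _ => ?_
  rw [map_mul, sliceFst_ofFst, sliceFst_ofSnd, mul_comm, ← Algebra.smul_def]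
  rfl

end CInfty

end Slices

/-! ### Taylor expansion modulo a Weil ideal -/

section Decomposition

open CInfty

variable {E F : Type} [NormedAddCommGroup E] [NormedSpace ℝ E] [FrolicherSpace E]
  [IsEuclideanFrolicher E] [FiniteDimensional ℝ E] [NormedAddCommGroup F] [NormedSpace ℝ F]
  [FrolicherSpace F] [IsEuclideanFrolicher F] [FiniteDimensional ℝ F]

/-- **Hadamard's lemma** with parameters. -/
theorem CInfty.sub_slice_zero_mem (H : CInfty (E × F)) :
    H - ofSnd (sliceSnd 0 H) ∈ (vanishing E).map (ofFst (Z := F)) := by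
  let e : (E × F) ≃L[ℝ] (Fin (Module.finrank ℝ (E × F)) → ℝ) :=
    ContinuousLinearEquiv.ofFinrankEq (by simp)
  have hH : ContDiff ℝ ∞ H.1 := (mem_functions_iff_contDiff _).1 H.2
  obtain ⟨G, hG, hsum⟩ := exists_smooth_sub_eq_sum (H.1 ∘ e.symm) (hH.comp e.symm.contDiff)
  -- The points `p` and `(0, p.2)` differ by `(p.1, 0)`, so the linear factors in the Taylor formula
  -- depend on the first variable alone and vanish at `0`.
  let r : Fin (Module.finrank ℝ (E × F)) → CInfty E := fun i =>
    ⟨fun x => e (x, 0) i, (mem_functions_iff_contDiff _).2 (by fun_prop)⟩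
  let K : Fin (Module.finrank ℝ (E × F)) → CInfty (E × F) := fun i =>
    ⟨fun p => G i (e p, e (0, p.2)),
      (mem_functions_iff_contDiff _).2 ((hG i).comp (by fun_prop))⟩
  have key : H - ofSnd (sliceSnd 0 H) = ∑ i, K i * ofFst (r i) := by
    refine ext_apply fun p => ?_
    have h1 := hsum (e p) (e (0, p.2))
    simp only [Function.comp_apply, ContinuousLinearEquiv.symm_apply_apply] at h1
    have h2 : ∀ i, e p i - e (0, p.2) i = e (p.1, 0) i := fun i => by
      have : p = (p.1, 0) + (0, p.2) := by simp
      conv_lhs => rw [this]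
      rw [map_add]
      simp
    have h3 : (∑ i, K i * ofFst (r i) : CInfty (E × F)).1 p = ∑ i, (K i).1 p * (r i).1 p.1 := by
      simp only [AddSubmonoidClass.coe_finsetSum, Finset.sum_apply]
      rfl
    rw [h3]
    change H.1 p - H.1 (0, p.2) = _
    rw [h1]
    exact Finset.sum_congr rfl fun i _ => by rw [h2, mul_comm]
  rw [key]
  refine Ideal.sum_mem _ fun i _ => Ideal.mul_mem_left _ _ (Ideal.mem_map_of_mem _ ?_)
  simp only [mem_vanishing, r]
  have : ((0, 0) : E × F) = 0 := rfl
  rw [this, map_zero, Pi.zero_apply]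

/-- Taylor expansion: modulo functions vanishing to high order in the first variable, a function
on a product is a sum of products. -/
theorem CInfty.exists_sub_mem_map_pow (N : ℕ) (H : CInfty (E × F)) :
    ∃ s ∈ Submodule.span ℝ {p : CInfty (E × F) | ∃ (b : CInfty E) (c : CInfty F),
      p = ofFst b * ofSnd c}, H - s ∈ ((vanishing E) ^ N).map (ofFst (Z := F)) := by
  induction N generalizing H with
  | zero => exact ⟨0, Submodule.zero_mem _, by simp [Ideal.one_eq_top, Ideal.map_top]⟩
  | succ N ih =>
    obtain ⟨s, hs, hHs⟩ := ih H
    -- The remainder is `∑ Gᵢ rᵢ` with `rᵢ` of order `N` in the first variable. Splitting `Gᵢ(0, ·)`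
    -- off each `Gᵢ` by Hadamard's lemma raises the order by one.
    obtain ⟨n, G, r, hsum⟩ := Submodule.mem_span_set'.1 hHs
    have hr : ∀ i, ∃ r' ∈ vanishing E ^ N, ofFst r' = (r i : CInfty (E × F)) := fun i => (r i).2
    choose r' hr' hrr using hr
    refine ⟨s + ∑ i, ofFst (r' i) * ofSnd (sliceSnd 0 (G i)),
      Submodule.add_mem _ hs (Submodule.sum_mem _ fun i _ => Submodule.subset_span ⟨_, _, rfl⟩), ?_⟩
    have h1 : H - (s + ∑ i, ofFst (r' i) * ofSnd (sliceSnd 0 (G i))) =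
        ∑ i, ofFst (r' i) * (G i - ofSnd (sliceSnd 0 (G i))) := by
      rw [← sub_sub, ← hsum, ← Finset.sum_sub_distrib]
      refine Finset.sum_congr rfl fun i _ => ?_
      rw [hrr, smul_eq_mul]; ring
    rw [h1, pow_succ, Ideal.map_mul]
    exact Ideal.sum_mem _ fun i _ =>
      Ideal.mul_mem_mul (Ideal.mem_map_of_mem _ (hr' i)) (sub_slice_zero_mem _)

theorem CInfty.exists_decomposition (N : ℕ) (H : CInfty (E × F)) :
    ∃ (n : ℕ) (b : Fin n → CInfty E) (c : Fin n → CInfty F),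
      H - ∑ i, ofFst (b i) * ofSnd (c i) ∈ ((vanishing E) ^ N).map (ofFst (Z := F)) := by
  obtain ⟨s, hs, hH⟩ := exists_sub_mem_map_pow N H
  obtain ⟨n, a, p, rfl⟩ := Submodule.mem_span_set'.1 hs
  choose b c hbc using fun i => (p i).2
  refine ⟨n, fun i => a i • b i, c, ?_⟩
  convert hH using 3 with i
  rw [hbc, map_smul, Algebra.smul_mul_assoc]

/-- The properties of the ideal of a Weil algebra that make its elements jets of finite order. -/
structure IsWeilIdeal (I : Ideal (CInfty E)) : Prop where
  finite_quotient : Module.Finite ℝ (CInfty E ⧸ I)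
  exists_pow_le : ∃ N, vanishing E ^ N ≤ I

namespace IsWeilIdeal

variable {I : Ideal (CInfty E)}

theorem exists_expansion (hI : IsWeilIdeal I) (H : CInfty (E × F)) :
    ∃ (n : ℕ) (b : Fin n → CInfty E) (c : Fin n → CInfty F),
      H - ∑ i, ofFst (b i) * ofSnd (c i) ∈ I.map (ofFst (Z := F)) := by
  obtain ⟨N, hN⟩ := hI.exists_pow_le
  obtain ⟨n, b, c, h⟩ := exists_decomposition N H
  exact ⟨n, b, c, Ideal.map_mono hN h⟩

theorem slice_mem_functions (hI : IsWeilIdeal I) (l : (CInfty E ⧸ I) →ₗ[ℝ] ℝ) (H : CInfty (E × F)) :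
    (fun z => l (Ideal.Quotient.mk I (sliceFst z H))) ∈ functions := by
  obtain ⟨n, b, c, h⟩ := hI.exists_expansion H
  simp only [mk_sliceFst_eq h, map_sum, map_smul, smul_eq_mul]
  refine (mem_functions_iff_contDiff _).2 (ContDiff.sum fun i _ => ?_)
  exact ((mem_functions_iff_contDiff _).1 (c i).2).mul contDiff_const

/-- Smoothness is tested along curves in `Z`, which reduces to the Euclidean parameter space `ℝ`. -/
theorem slice_mem_functions' {Z : Type*} [FrolicherSpace Z] (hI : IsWeilIdeal I)
    (l : (CInfty E ⧸ I) →ₗ[ℝ] ℝ)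
    (H : CInfty (E × Z)) : (fun z => l (Ideal.Quotient.mk I (sliceFst z H))) ∈ functions := by
  refine (mem_functions_iff _).2 fun d hd => ?_
  exact (mem_functions_iff_contDiff _).1 (hI.slice_mem_functions l
    (pullback ((SmoothMap.id E).prodMap (SmoothMap.ofCurve d hd)) H))

/-- The class of a function restricted to the diagonal, in terms of the classes of its slices. -/
theorem mk_restrictDiag_eq (hI : IsWeilIdeal I) {ι : Type*} [Fintype ι]
    (e : Module.Basis ι ℝ (CInfty E ⧸ I))
    (H : CInfty (E × E)) : Ideal.Quotient.mk I (restrictDiag H) = ∑ p, e p * Ideal.Quotient.mk I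
      ⟨fun z => e.coord p (Ideal.Quotient.mk I (sliceFst z H)),
        hI.slice_mem_functions (e.coord p) H⟩ := by
  obtain ⟨n, b, c, h⟩ := hI.exists_expansion H
  have h1 := Ideal.Quotient.eq.2 (by rw [← map_sub]; exact diag_mem_of_mem_map h :
    restrictDiag H - restrictDiag (∑ i, ofFst (b i) * ofSnd (c i)) ∈ I)
  have h2 : ∀ p, (⟨fun z => e.coord p (Ideal.Quotient.mk I (sliceFst z H)),
      hI.slice_mem_functions (e.coord p) H⟩ : CInfty E) =
      ∑ i, e.coord p (Ideal.Quotient.mk I (b i)) • c i := fun p => by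
    refine ext_apply fun z => ?_
    simp only [mk_sliceFst_eq h, map_sum, map_smul, AddSubmonoidClass.coe_finsetSum,
      Finset.sum_apply]
    exact Finset.sum_congr rfl fun i _ => mul_comm _ _
  have h3 : ∀ (r : ℝ) (f : CInfty E), Ideal.Quotient.mk I (r • f) = r • Ideal.Quotient.mk I f :=
    fun _ _ => rfl
  -- On the expansion the diagonal has class `∑ [bᵢ][cᵢ]`; it remains to write each `[bᵢ]` in the
  -- basis `e`.
  simp only [h1, h2, map_sum, map_mul, diag_ofFst, diag_ofSnd, h3, Finset.mul_sum]
  rw [Finset.sum_comm]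
  refine Finset.sum_congr rfl fun i _ => ?_
  conv_lhs => rw [← e.sum_repr (Ideal.Quotient.mk I (b i))]
  rw [Finset.sum_mul]
  have h4 : ∀ (r : ℝ) (x y : CInfty E ⧸ I), (r • x) * y = x * (r • y) := fun r x y =>
    (Algebra.smul_mul_assoc r x y).trans (Algebra.mul_smul_comm r x y).symm
  exact Finset.sum_congr rfl fun p _ => h4 _ _ _

end IsWeilIdeal

end Decomposition

/-! ### Smooth functionals and parametrised curves in prolongations -/

section LinearFunctionals

open CInfty

/-- A linear form on `C^∞(ℝ)` which is smooth as a map on the exponential `ℝ ^ ℝ`. -/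
structure SmoothFunctional where
  toLin : CInfty ℝ →ₗ[ℝ] ℝ
  mem_functions : (fun h : SmoothMap ℝ ℝ => toLin ⟨h, h.contDiff_real⟩) ∈ functions

/-- Absolutely convergent sums of point evaluations of a derivative. -/
noncomputable def SmoothFunctional.weightedSum (m : ℕ) (R : ℝ) (a : Set.Icc (-R) R → ℝ)
    (ha : Summable fun s => |a s|) : SmoothFunctional where
  toLin :=
    have hs : ∀ f : CInfty ℝ, Summable fun s : Set.Icc (-R) R => a s * iteratedDeriv m f.1 s :=
      fun f => by
        have hf : ContDiff ℝ ∞ f.1 := f.2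
        obtain ⟨C, hC⟩ := (isCompact_Icc (a := -R) (b := R)).exists_bound_of_continuousOn
          (hf.continuous_iteratedDeriv m (by exact_mod_cast le_top)).continuousOn
        refine .of_norm_bounded (ha.mul_right C) fun s => ?_
        rw [norm_mul]
        exact mul_le_mul_of_nonneg_left (hC s s.2) (abs_nonneg _)
    have hd : ∀ (f : CInfty ℝ) s, ContDiffAt ℝ m f.1 s := fun f s =>
      ((show ContDiff ℝ ∞ f.1 from f.2).of_le (by exact_mod_cast le_top)).contDiffAt
    { toFun := fun f => ∑' s, a s * iteratedDeriv m f.1 s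
      map_add' := fun f g => by
        rw [← (hs f).tsum_add (hs g)]
        refine tsum_congr fun s => ?_
        rw [← mul_add]
        congr 1
        exact iteratedDeriv_add (hd f s) (hd g s)
      map_smul' := fun r f => by
        rw [RingHom.id_apply, smul_eq_mul, ← tsum_mul_left]
        refine tsum_congr fun s => ?_
        rw [mul_left_comm]
        congr 1
        exact iteratedDeriv_const_mul r (hd f s) }
  mem_functions := weightedSum_mem_functions m R a ha

theorem SmoothFunctional.weightedSum_apply {m : ℕ} {R : ℝ} {a : Set.Icc (-R) R → ℝ}
    (ha : Summable fun s => |a s|) (f : CInfty ℝ) :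
    (weightedSum m R a ha).toLin f = ∑' s, a s * iteratedDeriv m f.1 s := rfl

namespace SmoothFunctional

variable (Λ : SmoothFunctional) {X : Type*} [FrolicherSpace X]

/-- A functional on `C^∞(ℝ)` applied to functions on `X × ℝ` in the second variable. -/
def partialApply : CInfty (X × ℝ) →ₗ[ℝ] CInfty X where
  toFun H := ⟨fun x => Λ.toLin (sliceSnd x H), (mem_functions_iff _).2 fun d hd => by
    have hc : (fun r => SmoothMap.ofFunction (sliceSnd (d r) H)) ∈ curves :=
      SmoothMap.mem_curves_iff_uncurry.2 fun s hs e he =>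
        (mem_functions_iff _).1 H.2 (fun t => (d (s t), e t))
          ⟨(SmoothMap.ofCurve d hd).smooth s hs, he⟩
    exact (mem_curves_iff _).1 hc _ Λ.mem_functions⟩
  map_add' H K := ext_apply fun x => by
    change Λ.toLin (sliceSnd x (H + K)) = Λ.toLin (sliceSnd x H) + Λ.toLin (sliceSnd x K)
    rw [map_add, map_add]
  map_smul' r H := ext_apply fun x => by
    change Λ.toLin (sliceSnd x (r • H)) = r • Λ.toLin (sliceSnd x H)
    rw [map_smul, map_smul]

theorem partialApply_ofFst_mul (b : CInfty X) (H : CInfty (X × ℝ)) :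
    Λ.partialApply (ofFst b * H) = b * Λ.partialApply H :=
  ext_apply fun x => by
    have h1 : sliceSnd x (ofFst b * H) = b.1 x • sliceSnd x H := rfl
    change Λ.toLin (sliceSnd x (ofFst b * H)) = b.1 x * Λ.toLin (sliceSnd x H)
    rw [h1, map_smul, smul_eq_mul]

theorem partialApply_ofSnd (c : CInfty ℝ) :
    Λ.partialApply (X := X) (ofSnd c) = algebraMap ℝ _ (Λ.toLin c) := rfl

/-- `Λ` acts in the second variable only, hence is linear over functions of the first. -/
theorem partialApply_mem {J : Ideal (CInfty X)} {H : CInfty (X × ℝ)}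
    (hH : H ∈ J.map (ofFst (Z := ℝ))) : Λ.partialApply H ∈ J := by
  obtain ⟨n, G, r, rfl⟩ := Submodule.mem_span_set'.1 hH
  have hr : ∀ i, ∃ r' ∈ J, ofFst r' = (r i : CInfty (X × ℝ)) := fun i => (r i).2
  choose r' hr' hrr using hr
  rw [map_sum]
  refine Ideal.sum_mem _ fun i _ => ?_
  rw [← hrr, smul_eq_mul, mul_comm, partialApply_ofFst_mul]
  exact Ideal.mul_mem_right _ _ (hr' i)

end SmoothFunctional

variable {E : Type} [NormedAddCommGroup E] [NormedSpace ℝ E] [FrolicherSpace E]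
  [IsEuclideanFrolicher E] [FiniteDimensional ℝ E] {I : Ideal (CInfty E)}

namespace IsWeilIdeal

/-- Smooth functionals commute with linear forms on a Weil algebra. -/
theorem functional_comm (hI : IsWeilIdeal I) (Λ : SmoothFunctional)
    (l : (CInfty E ⧸ I) →ₗ[ℝ] ℝ) (H : CInfty (E × ℝ)) :
    Λ.toLin ⟨fun s => l (Ideal.Quotient.mk I (sliceFst s H)), hI.slice_mem_functions l H⟩ =
      l (Ideal.Quotient.mk I (Λ.partialApply H)) := by
  -- On an expansion of `H` both sides become `∑ l[bᵢ] · Λ(cᵢ)`.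
  obtain ⟨n, b, c, h⟩ := hI.exists_expansion H
  have h1 : (⟨fun s => l (Ideal.Quotient.mk I (sliceFst s H)), hI.slice_mem_functions l H⟩ :
      CInfty ℝ) = ∑ i, l (Ideal.Quotient.mk I (b i)) • c i := by
    refine ext_apply fun z => ?_
    simp only [mk_sliceFst_eq h, map_sum, map_smul, AddSubmonoidClass.coe_finsetSum,
      Finset.sum_apply]
    exact Finset.sum_congr rfl fun i _ => mul_comm _ _
  have h2 := Ideal.Quotient.eq.2 (by rw [← map_sub]; exact Λ.partialApply_mem h :
    Λ.partialApply H - Λ.partialApply (∑ i, ofFst (b i) * ofSnd (c i)) ∈ I)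
  have h3 : ∀ i, Ideal.Quotient.mk I (Λ.partialApply (ofFst (b i) * ofSnd (c i))) =
      Λ.toLin (c i) • Ideal.Quotient.mk I (b i) := fun i => by
    rw [Λ.partialApply_ofFst_mul, Λ.partialApply_ofSnd, mul_comm, ← Algebra.smul_def]
    rfl
  rw [h1, h2, map_sum, map_sum, map_sum, map_sum]
  refine Finset.sum_congr rfl fun i _ => ?_
  rw [h3, map_smul, map_smul, smul_eq_mul, smul_eq_mul, mul_comm]

variable {X : Type*} [FrolicherSpace X]

/-- Curves in a Weil prolongation are jointly smooth with parameters in functions. -/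
theorem contDiff_evalFunction_slice (hI : IsWeilIdeal I) (l : (CInfty E ⧸ I) →ₗ[ℝ] ℝ)
    {c : ℝ → Prolongation X I} (hc : c ∈ curves) (B : CInfty (X × ℝ)) :
    ContDiff ℝ ∞ fun p : ℝ × ℝ => l (Prolongation.evalFunction I (sliceFst p.2 B) (c p.1)) := by
  have hrep : ∀ q : Prolongation X I, ∃ f, q = Prolongation.mk I f := fun q =>
    Quotient.inductionOn (s := prolongationSetoid X I) q fun f => ⟨f, rfl⟩
  -- The representatives are chosen for each `t` separately, with no regularity in `t`.
  choose f hf using fun t => hrep (c t)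
  let H : ℝ → CInfty (E × ℝ) := fun t => pullback ((f t).prodMap (SmoothMap.id ℝ)) B
  have hH : ∀ t s, Prolongation.evalFunction I (sliceFst s B) (c t) =
      Ideal.Quotient.mk I (sliceFst s (H t)) := fun t s => by rw [hf]; rfl
  have hsm : ∀ t, (fun s => l (Prolongation.evalFunction I (sliceFst s B) (c t))) ∈
      functions (X := ℝ) := fun t => by
    simp only [hH]; exact hI.slice_mem_functions l (H t)
  refine contDiff_of_smooth_sums (fun t => hsm t) fun m R a ha => ?_
  let Λ := SmoothFunctional.weightedSum m R a ha
  have hkey : ∀ t, ∑' s : Set.Icc (-R) R, a s * iteratedDeriv m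
      (fun s => l (Prolongation.evalFunction I (sliceFst s B) (c t))) s =
      l (Prolongation.evalFunction I (Λ.partialApply B) (c t)) := fun t => by
    have h1 : Prolongation.evalFunction I (Λ.partialApply B) (c t) =
        Ideal.Quotient.mk I (Λ.partialApply (H t)) := by rw [hf]; rfl
    rw [h1, ← hI.functional_comm Λ l (H t), SmoothFunctional.weightedSum_apply]
    simp only [hH]
  simp only [hkey]
  -- The weighted sum has become the evaluation of `c` at one fixed function on `X`, so the initial
  -- structure applies.
  exact hc _ ⟨_, l, rfl⟩

end IsWeilIdeal

end LinearFunctionals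

/-! ### Finite-dimensional local algebras -/

section FiniteAlgebras

theorem exists_maximalIdeal_pow_eq_bot (Q : Type*) [CommRing Q] [Algebra ℝ Q] [Module.Finite ℝ Q]
    [IsLocalRing Q] : ∃ N, IsLocalRing.maximalIdeal Q ^ N = ⊥ := by
  have : IsArtinianRing Q := IsArtinianRing.of_finite ℝ Q
  obtain ⟨N, hN⟩ := IsArtinianRing.isNilpotent_jacobson_bot (R := Q)
  rw [IsLocalRing.jacobson_eq_maximalIdeal ⊥ bot_ne_top] at hN
  exact ⟨N, hN⟩

/-- An element of the kernel cannot become a unit modulo `I`: applying `ev` to `f g - 1 ∈ I` would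
give `-1 = 0`. So the kernel maps into the maximal ideal, which is nilpotent. -/
theorem exists_ker_pow_le {R : Type*} [CommRing R] [Algebra ℝ R] (I : Ideal R)
    [Module.Finite ℝ (R ⧸ I)] [IsLocalRing (R ⧸ I)] (ev : R →+* ℝ) (hI : I ≤ RingHom.ker ev) :
    ∃ N, RingHom.ker ev ^ N ≤ I := by
  have h1 : (RingHom.ker ev).map (Ideal.Quotient.mk I) ≤ IsLocalRing.maximalIdeal (R ⧸ I) := by
    rw [Ideal.map_le_iff_le_comap]
    intro f hf
    rw [Ideal.mem_comap, IsLocalRing.mem_maximalIdeal, mem_nonunits_iff]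
    intro hu
    obtain ⟨q, hq⟩ := hu.exists_right_inv
    obtain ⟨g, rfl⟩ := Ideal.Quotient.mk_surjective q
    rw [← map_mul, ← map_one (Ideal.Quotient.mk I)] at hq
    have h2 := hI (Ideal.Quotient.eq.1 hq)
    rw [RingHom.mem_ker] at h2 hf
    simp [hf] at h2
  obtain ⟨N, hN⟩ := exists_maximalIdeal_pow_eq_bot (R ⧸ I)
  refine ⟨N, fun f hf => Ideal.Quotient.eq_zero_iff_mem.1 ?_⟩
  have h3 := Ideal.mem_map_of_mem (Ideal.Quotient.mk I) hf
  rw [Ideal.map_pow] at h3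
  simpa [hN] using Ideal.pow_right_mono h1 N h3

theorem finite_of_sum_products {A B Q : Type*} [CommRing A] [Algebra ℝ A] [Module.Finite ℝ A]
    [CommRing B] [Algebra ℝ B] [Module.Finite ℝ B] [CommRing Q] [Algebra ℝ Q]
    (φ : A →ₐ[ℝ] Q) (ψ : B →ₐ[ℝ] Q)
    (h : ∀ q, ∃ (n : ℕ) (a : Fin n → A) (b : Fin n → B), q = ∑ i, φ (a i) * ψ (b i)) :
    Module.Finite ℝ Q := by
  refine Module.Finite.of_surjective (Algebra.TensorProduct.productMap φ ψ).toLinearMap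
    fun q => ?_
  obtain ⟨n, a, b, rfl⟩ := h q
  refine ⟨∑ i, TensorProduct.tmul ℝ (a i) (b i), ?_⟩
  rw [map_sum]
  exact Finset.sum_congr rfl fun i _ => Algebra.TensorProduct.productMap_apply_tmul φ ψ _ _

end FiniteAlgebras

/-! ### Weil prolongation preserves products -/

section ProductProlongation

open CInfty

/-- Multiplication by an element of a quotient algebra, as a linear map. -/
def CInfty.mulLeft {X : Type*} [FrolicherSpace X] {I : Ideal (CInfty X)} (x : CInfty X ⧸ I) :
    (CInfty X ⧸ I) →ₗ[ℝ] (CInfty X ⧸ I) where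
  toFun y := x * y
  map_add' := mul_add x
  map_smul' r y := Algebra.mul_smul_comm r x y

variable {E : Type} [NormedAddCommGroup E] [NormedSpace ℝ E] [FrolicherSpace E]
  [IsEuclideanFrolicher E] [FiniteDimensional ℝ E] {I : Ideal (CInfty E)}
  {X Y : Type*} [FrolicherSpace X] [FrolicherSpace Y]

theorem Prolongation.exists_rep {M : Type} [FrolicherSpace M] [Zero M] {I : Ideal (CInfty M)}
    (q : Prolongation X I) : ∃ f, Prolongation.mk I f = q :=
  Quotient.inductionOn (s := prolongationSetoid X I) q fun f => ⟨f, rfl⟩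

namespace IsWeilIdeal

/-- A basis of the Weil algebra. -/
noncomputable def basis (hI : IsWeilIdeal I) :
    Module.Basis (Fin (Module.finrank ℝ (CInfty E ⧸ I))) ℝ (CInfty E ⧸ I) :=
  have := hI.finite_quotient
  have : Module.Free ℝ (CInfty E ⧸ I) := Module.Free.of_divisionRing ℝ _
  Module.finBasis ℝ (CInfty E ⧸ I)

/-- The function on `Y` obtained from a function on `X × Y`, a point of `X ⊗ W` and a linear form
on `W`. -/
def coeffFunction (hI : IsWeilIdeal I) (l : (CInfty E ⧸ I) →ₗ[ℝ] ℝ) (χ : CInfty (X × Y))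
    (q : Prolongation X I) : CInfty Y :=
  ⟨fun y => l (Prolongation.evalFunction I (sliceFst y χ) q), by
    obtain ⟨f, rfl⟩ := q.exists_rep
    exact hI.slice_mem_functions' l (pullback (f.prodMap (SmoothMap.id Y)) χ)⟩

/-- The right-hand side involves `f` and `g` only through their classes; this makes the pairing of
classes well defined. -/
theorem mk_pullback_pair (hI : IsWeilIdeal I) {ι : Type*} [Fintype ι]
    (e : Module.Basis ι ℝ (CInfty E ⧸ I)) (χ : CInfty (X × Y)) (f : SmoothMap E X)
    (g : SmoothMap E Y) : Ideal.Quotient.mk I (pullback (f.pair g) χ) =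
      ∑ p, e p * Prolongation.evalFunction I
        (hI.coeffFunction (e.coord p) χ (Prolongation.mk I f)) (Prolongation.mk I g) :=
  hI.mk_restrictDiag_eq e (pullback (f.prodMap g) χ)

/-- The pairing `X ⊗ W × Y ⊗ W → (X × Y) ⊗ W`. -/
def pairClass (hI : IsWeilIdeal I) (q : Prolongation X I) (r : Prolongation Y I) :
    Prolongation (X × Y) I :=
  Quotient.map₂ (sa := prolongationSetoid X I) (sb := prolongationSetoid Y I)
    (sc := prolongationSetoid (X × Y) I) (fun f g => f.pair g) (fun f f' hf g g' hg => by
      refine ⟨Prod.ext hf.1 hg.1, fun χ => Ideal.Quotient.eq.1 ?_⟩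
      have h1 : Prolongation.mk I f = Prolongation.mk I f' :=
        Quotient.sound (s := prolongationSetoid X I) hf
      have h2 : Prolongation.mk I g = Prolongation.mk I g' :=
        Quotient.sound (s := prolongationSetoid Y I) hg
      rw [hI.mk_pullback_pair hI.basis, hI.mk_pullback_pair hI.basis,
        h1, h2]) q r

theorem evalFunction_pairClass (hI : IsWeilIdeal I) {ι : Type*} [Fintype ι]
    (e : Module.Basis ι ℝ (CInfty E ⧸ I)) (χ : CInfty (X × Y)) (q : Prolongation X I)
    (r : Prolongation Y I) : Prolongation.evalFunction I χ (hI.pairClass q r) =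
      ∑ p, e p * Prolongation.evalFunction I (hI.coeffFunction (e.coord p) χ q) r := by
  obtain ⟨f, rfl⟩ := q.exists_rep
  obtain ⟨g, rfl⟩ := r.exists_rep
  exact hI.mk_pullback_pair e χ f g

/-- The coefficients along a curve, as a function on `Y × ℝ`. -/
def curveCoeffFunction (hI : IsWeilIdeal I) (l : (CInfty E ⧸ I) →ₗ[ℝ] ℝ) (χ : CInfty (X × Y))
    {c : ℝ → Prolongation X I} (hc : c ∈ curves) : CInfty (Y × ℝ) :=
  ⟨fun z => (hI.coeffFunction l χ (c z.2)).1 z.1, (mem_functions_iff _).2 fun b hb => by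
    -- Along a curve `b`, the time at which `c` is taken is `(b t).2`, while the sliced function
    -- depends on `t`. Joint smoothness in two independent times covers both.
    have h1 := hI.contDiff_evalFunction_slice l hc
      (pullback ((SmoothMap.id X).prodMap (SmoothMap.ofCurve _ hb.1)) χ)
    have h2 : ContDiff ℝ ∞ fun t => (((b t).2, t) : ℝ × ℝ) :=
      ContDiff.prodMk (show ContDiff ℝ ∞ (Prod.snd ∘ b) from hb.2) contDiff_id
    exact h1.comp h2⟩

/-- The coefficients of `c s` form a function on `Y × ℝ`, so the expression is jointly smooth in the
times of `c` and `d`, and in particular on the diagonal. -/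
theorem contDiff_coeffFunction (hI : IsWeilIdeal I) (l l' : (CInfty E ⧸ I) →ₗ[ℝ] ℝ)
    (χ : CInfty (X × Y)) {c : ℝ → Prolongation X I} {d : ℝ → Prolongation Y I}
    (hc : c ∈ curves) (hd : d ∈ curves) : ContDiff ℝ ∞ fun t =>
      l' (Prolongation.evalFunction I (hI.coeffFunction l χ (c t)) (d t)) := by
  have h1 := hI.contDiff_evalFunction_slice l' hd (hI.curveCoeffFunction l χ hc)
  have h2 : ContDiff ℝ ∞ fun t : ℝ => ((t, t) : ℝ × ℝ) := contDiff_id.prodMk contDiff_id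
  exact h1.comp h2

theorem pairClass_mem_curves (hI : IsWeilIdeal I) {c : ℝ → Prolongation X I}
    {d : ℝ → Prolongation Y I} (hc : c ∈ curves) (hd : d ∈ curves) :
    (fun t => hI.pairClass (c t) (d t)) ∈ curves := by
  rintro _ ⟨χ, l, rfl⟩
  have h1 : ∀ t, l (Prolongation.evalFunction I χ (hI.pairClass (c t) (d t))) =
      ∑ p, (l.comp (mulLeft (hI.basis p))) (Prolongation.evalFunction I
        (hI.coeffFunction (hI.basis.coord p) χ (c t)) (d t)) := fun t => by
    rw [hI.evalFunction_pairClass hI.basis, map_sum]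
    rfl
  exact Eq.mpr (congrArg (ContDiff ℝ ∞) (funext h1))
    (ContDiff.sum fun p _ => hI.contDiff_coeffFunction _ _ χ hc hd)

/-- Weil prolongation preserves products. -/
def prodIso (hI : IsWeilIdeal I) (X Y : Type*) [FrolicherSpace X] [FrolicherSpace Y] :
    FrolicherIso (Prolongation (X × Y) I) (Prolongation X I × Prolongation Y I) where
  hom := (Prolongation.map I SmoothMap.fst).pair (Prolongation.map I SmoothMap.snd)
  inv := ⟨fun p => hI.pairClass p.1 p.2, fun _ hc => hI.pairClass_mem_curves hc.1 hc.2⟩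
  inv_hom q := by
    obtain ⟨f, rfl⟩ := q.exists_rep
    rfl
  hom_inv := by
    rintro ⟨q, r⟩
    obtain ⟨f, rfl⟩ := q.exists_rep
    obtain ⟨g, rfl⟩ := r.exists_rep
    rfl

end IsWeilIdeal

end ProductProlongation

/-! ### Coproducts of Weil algebras -/

section WeilIdeals

open CInfty

theorem WeilAlgebra.isWeilIdeal (W : WeilAlgebra) : IsWeilIdeal W.I where
  finite_quotient := W.finite_quotient
  exists_pow_le :=
    have := W.finite_quotient
    have := W.local_quotient
    exists_ker_pow_le W.I ((Pi.evalRingHom _ 0).comp (CInfty (Fin W.k → ℝ)).val.toRingHom) W.vanish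

variable {E F : Type} [NormedAddCommGroup E] [NormedSpace ℝ E] [FrolicherSpace E]
  [IsEuclideanFrolicher E] [FiniteDimensional ℝ E] [NormedAddCommGroup F] [NormedSpace ℝ F]
  [FrolicherSpace F] [IsEuclideanFrolicher F] [FiniteDimensional ℝ F]

theorem vanishing_prod_le : vanishing (E × F) ≤
    (vanishing E).map (ofFst (Z := F)) ⊔ (vanishing F).map (ofSnd (X := E)) := by
  intro H hH
  have h1 : sliceSnd 0 H ∈ vanishing F := hH
  have h2 := Ideal.add_mem _ (Ideal.mem_sup_left (sub_slice_zero_mem H))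
    (Ideal.mem_sup_right (S := (vanishing E).map (ofFst (Z := F)))
      (Ideal.mem_map_of_mem (ofSnd (X := E)) h1))
  simpa using h2

/-- Product preservation is also needed for `W₁ ⊗_∞ W₂`, presented over `ℝᵏ × ℝˡ`. Expansions write
the quotient as sums of products from two finite algebras, and `(A + B)^(M + N) ≤ A^M + B^N` bounds
the order. -/
theorem IsWeilIdeal.coprod {I : Ideal (CInfty E)} {J : Ideal (CInfty F)} (hI : IsWeilIdeal I)
    (hJ : IsWeilIdeal J) : IsWeilIdeal (coprodIdeal I J) where
  finite_quotient := by
    have := hI.finite_quotient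
    have := hJ.finite_quotient
    let φ : (CInfty E ⧸ I) →ₐ[ℝ] CInfty (E × F) ⧸ coprodIdeal I J :=
      Ideal.quotientMapₐ _ (ofFst (Z := F)) (Ideal.map_le_iff_le_comap.1 le_sup_left)
    let ψ : (CInfty F ⧸ J) →ₐ[ℝ] CInfty (E × F) ⧸ coprodIdeal I J :=
      Ideal.quotientMapₐ _ (ofSnd (X := E)) (Ideal.map_le_iff_le_comap.1 le_sup_right)
    refine finite_of_sum_products (A := CInfty E ⧸ I) (B := CInfty F ⧸ J)
      (Q := CInfty (E × F) ⧸ coprodIdeal I J) φ ψ fun q => ?_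
    obtain ⟨H, rfl⟩ := Ideal.Quotient.mk_surjective q
    obtain ⟨n, b, c, h⟩ := hI.exists_expansion H
    refine ⟨n, fun i => Ideal.Quotient.mk I (b i), fun i => Ideal.Quotient.mk J (c i), ?_⟩
    have h1 := Ideal.Quotient.eq.2 (show _ ∈ coprodIdeal I J from Ideal.mem_sup_left h)
    rw [h1, map_sum]
    exact Finset.sum_congr rfl fun i _ => map_mul _ _ _
  exists_pow_le := by
    obtain ⟨M, hM⟩ := hI.exists_pow_le
    obtain ⟨N, hN⟩ := hJ.exists_pow_le
    refine ⟨M + N, (Ideal.pow_right_mono vanishing_prod_le _).trans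
      ((Ideal.sup_pow_add_le_pow_sup_pow).trans ?_)⟩
    rw [← Ideal.map_pow, ← Ideal.map_pow]
    exact sup_le_sup (Ideal.map_mono hM) (Ideal.map_mono hN)

end WeilIdeals

/-! ### Isomorphisms of Frölicher spaces -/

section Isomorphisms

namespace FrolicherIso

variable {X Y Z X' Y' : Type*} [FrolicherSpace X] [FrolicherSpace Y] [FrolicherSpace Z]
  [FrolicherSpace X'] [FrolicherSpace Y']

/-- The inverse isomorphism. -/
def symm (e : FrolicherIso X Y) : FrolicherIso Y X := ⟨e.inv, e.hom, e.hom_inv, e.inv_hom⟩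

/-- The composite of two isomorphisms. -/
def trans (e : FrolicherIso X Y) (f : FrolicherIso Y Z) : FrolicherIso X Z where
  hom := f.hom.comp e.hom
  inv := e.inv.comp f.inv
  inv_hom x := (congrArg e.inv (f.inv_hom (e.hom x))).trans (e.inv_hom x)
  hom_inv z := (congrArg f.hom (e.hom_inv (f.inv z))).trans (f.hom_inv z)

/-- The product of two isomorphisms. -/
def prodCongr (e : FrolicherIso X X') (f : FrolicherIso Y Y') :
    FrolicherIso (X × Y) (X' × Y') where
  hom := e.hom.prodMap f.hom
  inv := e.inv.prodMap f.inv
  inv_hom x := Prod.ext (e.inv_hom x.1) (f.inv_hom x.2)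
  hom_inv x := Prod.ext (e.hom_inv x.1) (f.hom_inv x.2)

/-- Isomorphic spaces have isomorphic exponentials. -/
def exponential (Z : Type*) [FrolicherSpace Z] (e : FrolicherIso X Y) :
    FrolicherIso (SmoothMap Z X) (SmoothMap Z Y) where
  hom := SmoothMap.postcomp Z e.hom
  inv := SmoothMap.postcomp Z e.inv
  inv_hom f := SmoothMap.ext fun z => e.inv_hom (f z)
  hom_inv f := SmoothMap.ext fun z => e.hom_inv (f z)

/-- Isomorphic spaces have isomorphic Weil prolongations. -/
def prolongation {M : Type} [FrolicherSpace M] [Zero M] (I : Ideal (CInfty M))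
    (e : FrolicherIso X Y) : FrolicherIso (Prolongation X I) (Prolongation Y I) where
  hom := Prolongation.map I e.hom
  inv := Prolongation.map I e.inv
  inv_hom q := by
    obtain ⟨f, rfl⟩ := q.exists_rep
    exact congrArg (Prolongation.mk I) (SmoothMap.ext fun z => e.inv_hom (f z))
  hom_inv q := by
    obtain ⟨f, rfl⟩ := q.exists_rep
    exact congrArg (Prolongation.mk I) (SmoothMap.ext fun z => e.hom_inv (f z))

/-- Exponentials preserve products. -/
def exponentialProd (X Y Z : Type*) [FrolicherSpace X] [FrolicherSpace Y] [FrolicherSpace Z] :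
    FrolicherIso (SmoothMap Z (X × Y)) (SmoothMap Z X × SmoothMap Z Y) where
  hom := (SmoothMap.postcomp Z SmoothMap.fst).pair (SmoothMap.postcomp Z SmoothMap.snd)
  inv := SmoothMap.pairing X Y Z
  inv_hom _ := rfl
  hom_inv _ := rfl

theorem injective (e : FrolicherIso X Y) : Function.Injective e.hom := fun x y h => by
  rw [← e.inv_hom x, h, e.inv_hom]

theorem bijective (e : FrolicherIso X Y) : Function.Bijective e.hom :=
  ⟨e.injective, fun y => ⟨e.inv y, e.hom_inv y⟩⟩

end FrolicherIso

end Isomorphisms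

/-! ### Weil exponentiability of products -/

section Exponentiability

/-- Two applications of product preservation, first for `W₁` and then for `W₂`. -/
theorem Prolongation.ext_prod {X Y : Type*} [FrolicherSpace X] [FrolicherSpace Y]
    (W₁ W₂ : WeilAlgebra) {q r : Prolongation (Prolongation (X × Y) W₁.I) W₂.I}
    (h₁ : map W₂.I (map W₁.I SmoothMap.fst) q = map W₂.I (map W₁.I SmoothMap.fst) r)
    (h₂ : map W₂.I (map W₁.I SmoothMap.snd) q = map W₂.I (map W₁.I SmoothMap.snd) r) : q = r := by
  refine (((W₁.isWeilIdeal.prodIso X Y).prolongation W₂.I).trans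
    (W₂.isWeilIdeal.prodIso _ _)).injective ?_
  obtain ⟨f, rfl⟩ := q.exists_rep
  obtain ⟨g, rfl⟩ := r.exists_rep
  exact Prod.ext h₁ h₂

/-- The product of two Weil-exponentiable spaces is Weil-exponentiable. -/
theorem IsWeilExponentiable.prod {X Y : Type u} [FrolicherSpace X] [FrolicherSpace Y]
    (hX : IsWeilExponentiable X) (hY : IsWeilExponentiable Y) : IsWeilExponentiable (X × Y) := by
  intro Z _ W₁ W₂
  obtain ⟨Θ, hΘ⟩ := hX Z W₁ W₂
  obtain ⟨Ψ, hΨ⟩ := hY Z W₁ W₂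
  have hI : IsWeilIdeal (coprodIdeal W₁.I W₂.I) := W₁.isWeilIdeal.coprod W₂.isWeilIdeal
  let source : FrolicherIso (SmoothMap Z (Prolongation (X × Y) (coprodIdeal W₁.I W₂.I)))
      (SmoothMap Z (Prolongation X (coprodIdeal W₁.I W₂.I)) ×
        SmoothMap Z (Prolongation Y (coprodIdeal W₁.I W₂.I))) :=
    ((hI.prodIso X Y).exponential Z).trans (.exponentialProd _ _ Z)
  let target : FrolicherIso (Prolongation (SmoothMap Z (Prolongation (X × Y) W₁.I)) W₂.I)
      (Prolongation (SmoothMap Z (Prolongation X W₁.I)) W₂.I ×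
        Prolongation (SmoothMap Z (Prolongation Y W₁.I)) W₂.I) :=
    ((((W₁.isWeilIdeal.prodIso X Y).exponential Z).trans
      (.exponentialProd _ _ Z)).prolongation W₂.I).trans (W₂.isWeilIdeal.prodIso _ _)
  refine ⟨(source.trans (Θ.prodCongr Ψ)).trans target.symm, fun h y F g hF hg => ?_⟩
  have hfst : ∀ q, (target.hom q).1 =
      Prolongation.map W₂.I (SmoothMap.postcomp Z (Prolongation.map W₁.I SmoothMap.fst)) q :=
    fun q => by obtain ⟨f, rfl⟩ := q.exists_rep; rfl
  have hsnd : ∀ q, (target.hom q).2 =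
      Prolongation.map W₂.I (SmoothMap.postcomp Z (Prolongation.map W₁.I SmoothMap.snd)) q :=
    fun q => by obtain ⟨f, rfl⟩ := q.exists_rep; rfl
  let r := target.inv ((Θ.prodCongr Ψ).hom (source.hom h))
  have hr := target.hom_inv ((Θ.prodCongr Ψ).hom (source.hom h))
  change Prolongation.map W₂.I (SmoothMap.evalAt y) r = _
  -- The projections of `F` and `g` satisfy the hypotheses in the canonical form of `Θ` and of `Ψ`.
  have e1 := hΘ (source.hom h).1 y (SmoothMap.fst.comp F)
    ((Prolongation.map W₁.I SmoothMap.fst).comp g)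
    (congrArg (Prolongation.map _ SmoothMap.fst) hF)
    (fun z => congrArg (Prolongation.map _ SmoothMap.fst) (hg z))
  have e2 := hΨ (source.hom h).2 y (SmoothMap.snd.comp F)
    ((Prolongation.map W₁.I SmoothMap.snd).comp g)
    (congrArg (Prolongation.map _ SmoothMap.snd) hF)
    (fun z => congrArg (Prolongation.map _ SmoothMap.snd) (hg z))
  have e3 := (hfst r).symm.trans (congrArg Prod.fst hr)
  have e4 := (hsnd r).symm.trans (congrArg Prod.snd hr)
  refine Prolongation.ext_prod W₁ W₂ ?_ ?_
  · refine Eq.trans ?_ e1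
    -- Evaluation at `y` commutes with the projections, as is seen on representatives.
    refine Eq.trans ?_ (congrArg (Prolongation.map W₂.I (SmoothMap.evalAt y)) e3)
    obtain ⟨f, hf⟩ := r.exists_rep
    rw [← hf]; rfl
  · refine Eq.trans ?_ e2
    refine Eq.trans ?_ (congrArg (Prolongation.map W₂.I (SmoothMap.evalAt y)) e4)
    obtain ⟨f, hf⟩ := r.exists_rep
    rw [← hf]; rfl

theorem Extended.bijective_prod (C : CahiersObj) (X Y : Type u) [FrolicherSpace X]
    [FrolicherSpace Y] : Function.Bijective fun q : Extended (X × Y) C =>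
      (Extended.map C (SmoothMap.fst : SmoothMap (X × Y) X) q,
        Extended.map C (SmoothMap.snd : SmoothMap (X × Y) Y) q) := by
  have h := (((FrolicherIso.exponentialProd X Y (Fin C.n → ℝ)).prolongation C.W.I).trans
    (C.W.isWeilIdeal.prodIso _ _)).bijective
  convert h using 1
  funext q
  obtain ⟨f, rfl⟩ := q.exists_rep
  rfl

end Exponentiability

/-! ### Products in the functor category -/

section Products

/-- A pair of natural transformations of set-valued functors which is pointwise bijective onto the
product exhibits a product. -/
noncomputable def binaryFanIsLimitOfBijective {D : Type*} [Category* D] {F G H : D ⥤ Type u}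
    (p : F ⟶ G) (q : F ⟶ H)
    (h : ∀ C, Function.Bijective fun x : F.obj C => (p.app C x, q.app C x)) :
    IsLimit (BinaryFan.mk p q) :=
  let e C := Equiv.ofBijective _ (h C)
  have hp : ∀ C y, p.app C ((e C).symm y) = y.1 := fun C y =>
    congrArg Prod.fst ((e C).apply_symm_apply y)
  have hq : ∀ C y, q.app C ((e C).symm y) = y.2 := fun C y =>
    congrArg Prod.snd ((e C).apply_symm_apply y)
  BinaryFan.isLimitMk
    (fun s =>
      { app := fun C => ↾fun x => (e C).symm (s.fst.app C x, s.snd.app C x)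
        naturality := fun C C' α => by
          ext x
          -- Naturality may be checked after both projections, which are jointly injective and
          -- natural.
          apply (h C').1
          refine Prod.ext ?_ ?_
          · have h1 := ConcreteCategory.congr_hom (s.fst.naturality α) x
            have h2 := ConcreteCategory.congr_hom (p.naturality α)
              ((e C).symm (s.fst.app C x, s.snd.app C x))
            exact ((hp C' (s.fst.app C' (s.pt.map α x), s.snd.app C' (s.pt.map α x))).trans h1).trans
              (h2.trans (congrArg (G.map α) (hp C (s.fst.app C x, s.snd.app C x)))).symm
          · have h1 := ConcreteCategory.congr_hom (s.snd.naturality α) x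
            have h2 := ConcreteCategory.congr_hom (q.naturality α)
              ((e C).symm (s.fst.app C x, s.snd.app C x))
            exact ((hq C' (s.fst.app C' (s.pt.map α x), s.snd.app C' (s.pt.map α x))).trans h1).trans
              (h2.trans (congrArg (H.map α) (hq C (s.fst.app C x, s.snd.app C x)))).symm })
    (fun s => by ext C x; exact hp C _)
    (fun s => by ext C x; exact hq C _)
    (fun s m h1 h2 => by
      ext C x
      apply (h C).1
      refine Prod.ext ?_ ?_
      · exact (ConcreteCategory.congr_hom (NatTrans.congr_app h1 C) x).trans
          (hp C (s.fst.app C x, s.snd.app C x)).symm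
      · exact (ConcreteCategory.congr_hom (NatTrans.congr_app h2 C) x).trans
          (hq C (s.fst.app C x, s.snd.app C x)).symm)

theorem isIso_prodLift_of_isLimit {C : Type*} [Category* C] {P A B : C} [HasBinaryProduct A B]
    {f : P ⟶ A} {g : P ⟶ B} (h : IsLimit (BinaryFan.mk f g)) : IsIso (prod.lift f g) := by
  have h1 : prod.lift f g = (h.conePointUniqueUpToIso (prodIsProd A B)).hom := by
    refine Limits.prod.hom_ext ?_ ?_
    · rw [prod.lift_fst]
      exact (h.conePointUniqueUpToIso_hom_comp (prodIsProd A B) ⟨WalkingPair.left⟩).symm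
    · rw [prod.lift_snd]
      exact (h.conePointUniqueUpToIso_hom_comp (prodIsProd A B) ⟨WalkingPair.right⟩).symm
  rw [h1]
  infer_instance

/-- The product of Frölicher spaces is a product of Weil-exponentiable spaces. -/
def FSWE.prodIsLimit (X Y : FSWE.{u}) (h : IsWeilExponentiable (X.obj.carrier × Y.obj.carrier)) :
    IsLimit (BinaryFan.mk (FSWE.fst X Y h) (FSWE.snd X Y h)) :=
  BinaryFan.isLimitMk
    (fun s => ObjectProperty.homMk (SmoothMap.pair
      (X := X.obj.carrier) (Y := Y.obj.carrier) s.fst.hom s.snd.hom))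
    (fun _ => rfl) (fun _ => rfl)
    (fun s m h1 h2 => by
      rw [← h1, ← h2]
      rfl)

variable (T : ProlongationFunctoriality.{u})

/-- Currying pairs `φ` with the identity of `C`, whose action is trivial. -/
theorem ProlongationFunctoriality.J_map_app {X Y : FSWE.{u}} (φ : X ⟶ Y) (C : CahiersObj)
    (q : (T.J.obj X).obj C) : (T.J.map φ).app C q = Extended.map C φ.hom q :=
  congrArg (Extended.map C φ.hom) (T.act_id X C q)

/-- The functor `J` maps products to products. -/
noncomputable def ProlongationFunctoriality.isLimitJ (X Y : FSWE.{u})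
    (h : IsWeilExponentiable (X.obj.carrier × Y.obj.carrier)) :
    IsLimit (BinaryFan.mk (T.J.map (FSWE.fst X Y h)) (T.J.map (FSWE.snd X Y h))) :=
  binaryFanIsLimitOfBijective _ _ fun C => by
    simp only [T.J_map_app]
    exact Extended.bijective_prod C X.obj.carrier Y.obj.carrier

end Products

theorem proposition5p10 (T : ProlongationFunctoriality.{u}) :
    (∀ X Y : FSWE.{u}, ∃ h : IsWeilExponentiable (X.obj.carrier × Y.obj.carrier),
      IsIso (prod.lift (T.J.map (FSWE.fst X Y h)) (T.J.map (FSWE.snd X Y h)))) ∧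
    PreservesLimitsOfShape (Discrete WalkingPair) T.J := by
  refine ⟨fun X Y => ⟨X.property.prod Y.property, ?_⟩, ⟨fun {K} => ?_⟩⟩
  · exact isIso_prodLift_of_isLimit (T.isLimitJ X Y _)
  -- Preserving one limit cone suffices, and every diagram on two points is isomorphic to a pair.
  · have h : ∀ X Y : FSWE.{u}, PreservesLimit (pair X Y) T.J := fun X Y =>
      preservesLimit_of_preserves_limit_cone (FSWE.prodIsLimit X Y (X.property.prod Y.property))
        ((isLimitMapConeBinaryFanEquiv T.J _ _).symm (T.isLimitJ X Y _))
    have := h (K.obj ⟨WalkingPair.left⟩) (K.obj ⟨WalkingPair.right⟩)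
    exact preservesLimit_of_iso_diagram T.J (diagramIsoPair K).symm
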